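/- **Setting.** Let $\mathbb R^m=\mathbb R^{m_1}\times\dots\times\mathbb R^{m_d}$, $x=(x_1,\dots,x_d)$, let $A\in\mathbb R^{q\times m}$, $A\neq0$, $b\in\mathbb R^q$, $h(x)=\frac12\|Ax-b\|^2$ and $\mathcal X=\arg\min h$. Consider $\min_{x\in\mathcal X}\Psi(x)$ with $\Psi=\Phi+R$, $\Phi(x)=\sum_i\phi_i(x_i)$, $R(x)=\sum_i r_i(x_i)$, where each $\phi_i:\mathbb R^{m_i}\to\mathbb R$ is differentiable with $$0\le \phi_i(u+t)-\phi_i(u)-\langle\nabla\phi_i(u),t\rangle\le \tfrac{L_i}{2}\|t\|^2\qquad (u,t\in\mathbb R^{m_i}),\quad L_i>0,$$ and each $r_i:\mathbb R^{m_i}\to(-\infty,\infty]$ is proper, lower semicontinuous and $\mu_i$-strongly convex with $\mu_i>0$. Assume that there is a saddle point, i.e. a pair $(x^*,y^*)$ with $A^\top Ay^*\in\partial\Psi(x^*)$ and $A^\top Ax^*=A^\top b$. **Sampling.** Let $\iota_0,\iota_1,\dots$ be i.i.d. random subsets of $\{1,\dots,d\}$ with $\mathbb P(i\in\iota_k)=\pi\in(0,1)$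 for all $i$. Put $\Lambda=\mathrm{blkdiag}(L_iI)$, $\Upsilon=\mathrm{blkdiag}(\mu_iI)$, $P=\pi^{-1}I$, let $E_k$ be the block diagonal $0/1$ matrix that selects the blocks in $\iota_k$, and let $\Xi=\mathbb E[E_kPA^\top APE_k]$, $M=P^{-1}\Upsilon$. **Step sizes.** Let $$\alpha=\lambda_{\max}(M^{-1/2}\Xi M^{-1/2})^{-1},\quad \beta=\alpha\,\lambda_{\max}(M^{-1/2}(\Lambda+\Upsilon)M^{-1/2}),\quad \kappa=\beta/\alpha,$$ let $\tau_0\in(0,1/\kappa)$ and, for $k\ge0$, let $\tau_{k+1}$ be the positive root $s$ of $\bigl(1-(\kappa-\frac1\pi)\tau_k-\kappa\tau_k^2\bigr)s^2+(\kappa-\frac1\pi+1)\tau_k^2s-\tau_k^2=0$, that is $$\tau_{k+1}=\frac{\frac{\tau_k^2}{2}\left(\frac1\pi-\kappa-1\right)+\tau_k\sqrt{\left(1+(\frac1\pi-\kappa)\frac{\tau_k}{2}\right)^2-\left(\frac{2-\pi}{\pi}+2\kappa\right)\frac{\tau_k^2}{4}}}{1+\tau_k(\frac1\pi-\kappa)-\kappa\tau_k^2}.$$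 Let $\sigma_k\tau_k=\alpha-\beta\tau_k$, $S_0=1$, $S_k=S_{k-1}+\sigma_k$ for $k\ge1$, $\theta_k=\sigma_k/S_k$, and assume that $\theta_0=\sigma_0\le\pi$. **Algorithm.** Let $x^0=w^0\in\mathrm{dom}\,R$ be deterministic and, for $k\ge0$, $$z^k=(1-\theta_k)w^k+\theta_kx^k,\qquad w^{k+1}=z^k+\theta_kP(x^{k+1}-x^k),$$ where $x_i^{k+1}=x_i^k$ for $i\notin\iota_k$ and, for $i\in\iota_k$, $$x_i^{k+1}=\arg\min_{u\in\mathbb R^{m_i}}\Bigl\{r_i(u)+\langle\nabla\phi_i(x_i^k)+S_k\nabla_ih(z^k),u-x_i^k\rangle+\tfrac12\cdot\tfrac{\pi\mu_i}{\tau_k}\|u-x_i^k\|^2\Bigr\}.$$ **Conclusion.** The problem $\min_{x\in\mathcal X}\Psi(x)$ has a unique solution $\bar x$, and (i) almost surely, $h(x^k)-h(\bar x)=o(k^{-2})$ and $h(w^k)-h(\bar x)=O(k^{-4})$; (ii) almost surely, $x^k\to\bar x$ and $w^k\to\bar x$; (iii) almost surely, $\Psi(w^k)<\infty$ for all $k$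 and $|\Psi(w^k)-\Psi(\bar x)|=O(k^{-2})$; moreover $\Psi(w^k)$ is integrable for every $k$ and $\mathbb E\,|\Psi(w^k)-\Psi(\bar x)|=O(k^{-2})$. The constants in the almost sure $O(\cdot)$ bounds may depend on the realisation. -/

import Mathlib

open Filter Topology MeasureTheory ProbabilityTheory Asymptotics
open scoped Matrix Gradient

noncomputable section

namespace RBCD

/-- The space `ℝ^m = ℝ^{m_1} × ⋯ × ℝ^{m_d}` with its Euclidean norm; the coordinate `⟨i, j⟩` is the
`j`-th coordinate of the `i`-th block. -/
abbrev Vec {d : ℕ} (m : Fin d → ℕ) : Type := EuclideanSpace ℝ (Σ i, Fin (m i))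

/-- The space `ℝ^{m_i}` of the `i`-th block. -/
abbrev Blk {d : ℕ} (m : Fin d → ℕ) (i : Fin d) : Type := EuclideanSpace ℝ (Fin (m i))

/-- The `i`-th block `x_i` of `x`. -/
def blk {d : ℕ} {m : Fin d → ℕ} (i : Fin d) (x : Vec m) : Blk m i :=
  WithLp.toLp 2 fun j => x ⟨i, j⟩

/-- The vector with the given blocks. -/
def ofBlks {d : ℕ} {m : Fin d → ℕ} (y : ∀ i, Blk m i) : Vec m :=
  WithLp.toLp 2 fun a => y a.1 a.2

/-- Data of the problem: minimise `Ψ(x) = ∑ i, φ i (x_i) + ∑ i, r i (x_i)` over the least squares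
solutions of `A x = b`, together with the smoothness moduli `L i` of `φ i` and the moduli `μ i` of
strong convexity of `r i`. -/
structure Data (d q : ℕ) (m : Fin d → ℕ) where
  A : Matrix (Fin q) (Σ i, Fin (m i)) ℝ
  b : EuclideanSpace ℝ (Fin q)
  φ : ∀ i, Blk m i → ℝ
  r : ∀ i, Blk m i → EReal
  L : Fin d → ℝ
  μ : Fin d → ℝ

namespace Data

variable {d q : ℕ} {m : Fin d → ℕ} (D : Data d q m)

/-- The matrix-vector product `A x` as a Euclidean vector. -/
def mulA (x : Vec m) : EuclideanSpace ℝ (Fin q) := WithLp.toLp 2 (D.A *ᵥ x.ofLp)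

/-- The quadratic penalty `h(x) = ½ ‖A x - b‖²`. -/
def h (x : Vec m) : ℝ := 1 / 2 * ‖D.mulA x - D.b‖ ^ 2

/-- `Φ(x) = ∑ i, φ i (x_i)`. -/
def Phi (x : Vec m) : ℝ := ∑ i, D.φ i (blk i x)

/-- `R(x) = ∑ i, r i (x_i)`. -/
def R (x : Vec m) : EReal := ∑ i, D.r i (blk i x)

/-- The objective `Ψ = Φ + R`. -/
def Psi (x : Vec m) : EReal := (D.Phi x : EReal) + D.R x

/-- The feasible set: the minimisers of `h`. -/
def feasible : Set (Vec m) := {x | ∀ u, D.h x ≤ D.h u}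

/-- The set of solutions of `min {Ψ(x) | x feasible}`. -/
def solutions : Set (Vec m) :=
  {x | x ∈ D.feasible ∧ D.Psi x ≠ ⊤ ∧ ∀ u ∈ D.feasible, D.Psi x ≤ D.Psi u}

/-- Standing assumptions on the functions: every `φ i` is a differentiable convex function that
satisfies the descent inequality with modulus `L i > 0`, and every `r i` is a proper, lower
semicontinuous function with values in `(-∞, ∞]` that is `μ i`-strongly convex with `μ i > 0`. -/
structure Regular : Prop where
  L_pos : ∀ i, 0 < D.L i
  differentiable : ∀ i, Differentiable ℝ (D.φ i)
  convex : ∀ i (x t : Blk m i), 0 ≤ D.φ i (x + t) - D.φ i x - inner ℝ (∇ (D.φ i) x) t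
  descent : ∀ i (x t : Blk m i),
    D.φ i (x + t) - D.φ i x - inner ℝ (∇ (D.φ i) x) t ≤ D.L i / 2 * ‖t‖ ^ 2
  μ_pos : ∀ i, 0 < D.μ i
  ne_bot : ∀ i x, D.r i x ≠ ⊥
  proper : ∀ i, ∃ x, D.r i x ≠ ⊤
  lsc : ∀ i, LowerSemicontinuous (D.r i)
  strongConvex : ∀ i, StrongConvexOn {x | D.r i x ≠ ⊤} (D.μ i) fun x => (D.r i x).toReal

/-- `g ∈ ∂Ψ(x)`, the convex subdifferential. -/
def IsSubgradient (g x : Vec m) : Prop :=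
  D.Psi x ≠ ⊤ ∧ ∀ u, D.Psi x + ((inner ℝ g (u - x) : ℝ) : EReal) ≤ D.Psi u

/-- `(x, y)` is a saddle point: `0 ∈ ∂Ψ(x) - AᵀA y` and `AᵀA x - Aᵀ b = 0`. -/
def IsSaddle (x y : Vec m) : Prop :=
  D.IsSubgradient (WithLp.toLp 2 ((D.Aᵀ * D.A) *ᵥ y.ofLp)) x ∧
    (D.Aᵀ * D.A) *ᵥ x.ofLp - D.Aᵀ *ᵥ D.b.ofLp = 0

/-- `Λ = blkdiag(L_1 I, …, L_d I)`. -/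
def Lam : Matrix (Σ i, Fin (m i)) (Σ i, Fin (m i)) ℝ := Matrix.diagonal fun a => D.L a.1

/-- `Υ = blkdiag(μ_1 I, …, μ_d I)`. -/
def Ups : Matrix (Σ i, Fin (m i)) (Σ i, Fin (m i)) ℝ := Matrix.diagonal fun a => D.μ a.1

end Data

/-- `P = blkdiag(π_i⁻¹ I)` for the uniform sampling `π_i = p`. -/
def Pmat {d : ℕ} (m : Fin d → ℕ) (p : ℝ) : Matrix (Σ i, Fin (m i)) (Σ i, Fin (m i)) ℝ :=
  Matrix.diagonal fun _ => 1 / p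

/-- The activation matrix of a set `I` of blocks: the identity on the blocks in `I`, and zero on the
others. -/
def actMat {d : ℕ} (m : Fin d → ℕ) (I : Finset (Fin d)) :
    Matrix (Σ i, Fin (m i)) (Σ i, Fin (m i)) ℝ :=
  Matrix.diagonal fun a => if a.1 ∈ I then 1 else 0

/-- `ι 0, ι 1, …` is an i.i.d. sampling of blocks, uniform with `Pr(i ∈ ι k) = p ∈ (0, 1)` for all
blocks `i`. -/
structure IsUniformSampling {Ω : Type*} [MeasurableSpace Ω] (Pr : Measure Ω) {d : ℕ}
    (ι : ℕ → Ω → Finset (Fin d)) (p : ℝ) : Prop where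
  measurable : ∀ k, Measurable (ι k)
  indep : iIndepFun ι Pr
  identDistrib : ∀ k, IdentDistrib (ι k) (ι 0) Pr Pr
  p_pos : 0 < p
  p_lt_one : p < 1
  uniform : ∀ i, Pr.real {ω | i ∈ ι 0 ω} = p

/-- The largest eigenvalue of a real square matrix. -/
def lamMax {n : Type*} [Fintype n] [DecidableEq n] (M : Matrix n n ℝ) : ℝ := sSup (spectrum ℝ M)

section StepSizes

variable {d q : ℕ} {m : Fin d → ℕ} (D : Data d q m)

/-- `Ξ = 𝔼[E P AᵀA P E]`, with `E` the activation matrix of the random set `I`. -/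
def Xi {Ω : Type*} [MeasurableSpace Ω] (Pr : Measure Ω) (I : Ω → Finset (Fin d)) (p : ℝ) :
    Matrix (Σ i, Fin (m i)) (Σ i, Fin (m i)) ℝ :=
  Matrix.of fun a c => ∫ ω, (actMat m (I ω) * Pmat m p * D.Aᵀ * D.A * Pmat m p * actMat m (I ω)) a c ∂Pr

/-- `M^{-1/2}` for the positive diagonal matrix `M = P⁻¹ Υ`. -/
def Mrt (p : ℝ) : Matrix (Σ i, Fin (m i)) (Σ i, Fin (m i)) ℝ :=
  Matrix.diagonal fun a => 1 / √(p * D.μ a.1)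

/-- `α = λ_max(M^{-1/2} Ξ M^{-1/2})⁻¹`. -/
def alpha {Ω : Type*} [MeasurableSpace Ω] (Pr : Measure Ω) (I : Ω → Finset (Fin d)) (p : ℝ) : ℝ :=
  (lamMax (Mrt D p * Xi D Pr I p * Mrt D p))⁻¹

/-- `λ_max(M^{-1/2} (Λ + Υ) M^{-1/2})`, the value of `β / α`. -/
def kappa (p : ℝ) : ℝ := lamMax (Mrt D p * (D.Lam + D.Ups) * Mrt D p)

/-- `β = α λ_max(M^{-1/2} (Λ + Υ) M^{-1/2})`. -/
def beta {Ω : Type*} [MeasurableSpace Ω] (Pr : Measure Ω) (I : Ω → Finset (Fin d)) (p : ℝ) : ℝ :=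
  alpha D Pr I p * kappa D p

/-- One step of the recursion for `τ`: the positive root `s` of
`(1 - (κ - 1/p) t - κ t²) s² + (κ - 1/p + 1) t² s - t² = 0`. -/
def tauNext (κ p t : ℝ) : ℝ :=
  (t ^ 2 / 2 * (1 / p - κ - 1) +
      t * √((1 + (1 / p - κ) * t / 2) ^ 2 - ((2 - p) / p + 2 * κ) * t ^ 2 / 4)) /
    (1 + t * (1 / p - κ) - κ * t ^ 2)

/-- The step sizes `τ_k`. -/
def tau (κ p τ₀ : ℝ) : ℕ → ℝ
  | 0 => τ₀
  | k + 1 => tauNext κ p (tau κ p τ₀ k)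

/-- The coupled step sizes `σ_k`, defined by `σ_k τ_k = α - β τ_k`. -/
def sigma (α β : ℝ) (τ : ℕ → ℝ) (k : ℕ) : ℝ := (α - β * τ k) / τ k

/-- `S_0 = 1`, `S_{k+1} = S_k + σ_{k+1}`. -/
def weight (σ : ℕ → ℝ) : ℕ → ℝ
  | 0 => 1
  | k + 1 => weight σ k + σ (k + 1)

/-- `θ_k = σ_k / S_k`. -/
def theta (σ : ℕ → ℝ) (k : ℕ) : ℝ := σ k / weight σ k

end StepSizes

section Algorithm

variable {d q : ℕ} {m : Fin d → ℕ} (D : Data d q m)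

/-- The objective of the forward-backward step of block `i`, with signal `g`, base point `y` and
`Q_i = c I`: `r_i(u) + ⟨g, u - y⟩ + ½ ‖u - y‖²_{Q_i}`. -/
def fbObj (i : Fin d) (g y : Blk m i) (c : ℝ) (u : Blk m i) : EReal :=
  D.r i u + ((inner ℝ g (u - y) + 1 / 2 * (c * ‖u - y‖ ^ 2) : ℝ) : EReal)

open Classical in
/-- The forward-backward operator: the minimiser of the objective above (which exists and is unique
when `r i` is proper, closed and convex and `c > 0`). -/
def FB (i : Fin d) (g y : Blk m i) (c : ℝ) : Blk m i :=
  Classical.epsilon fun û => ∀ u, fbObj D i g y c û ≤ fbObj D i g y c u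

/-- The extrapolated point `z = w + θ (x - w)`, for the pair `s = (x, w)`. -/
def zPoint (θ : ℝ) (s : Vec m × Vec m) : Vec m := s.2 + θ • (s.1 - s.2)

/-- The new `x`: the blocks in `I` take a forward-backward step with signal
`g_i = ∇φ_i(x_i) + S ∇_i h(z)` and `Q_i = (p t)⁻¹ B_i`, where `B = P⁻² Υ`, so `B_i = p² μ_i I`; the
other blocks do not move. -/
def xNext (p t S θ : ℝ) (I : Finset (Fin d)) (s : Vec m × Vec m) : Vec m :=
  ofBlks fun i =>
    if i ∈ I then
      FB D i (∇ (D.φ i) (blk i s.1) + S • blk i (∇ D.h (zPoint θ s))) (blk i s.1)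
        (1 / (p * t) * (p ^ 2 * D.μ i))
    else blk i s.1

/-- The pair `(x^k, w^k)`, for the realised sets `I 0, I 1, …` of active blocks. -/
def iter (p : ℝ) (τ σ : ℕ → ℝ) (x₀ : Vec m) (I : ℕ → Finset (Fin d)) : ℕ → Vec m × Vec m
  | 0 => (x₀, x₀)
  | k + 1 =>
    let s := iter p τ σ x₀ I k
    let x' := xNext D p (τ k) (weight σ k) (theta σ k) (I k) s
    (x', zPoint (theta σ k) s + theta σ k • WithLp.toLp 2 (Pmat m p *ᵥ (x' - s.1).ofLp))

end Algorithm

end RBCD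

end

/-! The proof is a Lyapunov argument. With T_k = S_k - σ_k, ρ_k = σ_k (1/τ_k + 1/p - 1), a saddle
point (x*, y) and an upper estimate f_k of Ψ(w^k), put V_k = T_k (f_k - Ψ(x*)) + T_k²/2 ‖A(w^k -
x*)‖² + ρ_k/2 ‖x^k - x*‖²_μ. By `sum_lyap_le` the conditional mean of V_{k+1} is at most V_k -
σ_k²/2 ‖A(x^k - x*)‖². The coupling σ_k = α(1/τ_k - κ) makes the proximal term absorb both the
second moment of the sampled step (through α) and the smoothness error (through κ). The recursion
for τ says ρ_{k+1} = σ_k (1/τ_k + 1/p), so that consecutive steps chain.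

The conditional mean of Ψ(w^{k+1}) is not directly accessible. Hence f_k is `psiHat`, the
combination of the values Ψ(x^j) with the coefficients that express w^k through the x^j: it is
affine in Ψ(x^{k+1}), whose conditional mean depends only on p. That f_k ≥ Ψ(w^k) is Jensen's
inequality; the coefficients are nonnegative because σ_0 ≤ p and (1-p)σ_{k+1} ≤ σ_k
(`exists_epigraph_combination`).

V_k may be negative, but the saddle inequality Ψ(w) ≥ Ψ(x*) + ⟨Ay, A(w - x*)⟩ + ½‖w - x*‖²_μ and
completion of the square give V_k + ½‖Ay‖² ≥ T_k/2 ‖w^k - x*‖²_μ + ½‖T_k A(w^k - x*) + Ay‖² + ρ_k/2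
‖x^k - x*‖²_μ. With the accumulated decrease added, this is a nonnegative supermartingale
(`energy`), so it is almost surely bounded and its mean is bounded. Since T_k, σ_k² and ρ_k are all
at least c k² (`exists_sq_le`), the rates follow: T_k‖A(w^k - x*)‖ is bounded, σ_j²‖A(x^j - x*)‖² is
summable, and T_k|Ψ(w^k) - Ψ(x*)| is at most an affine function of the energy, which also settles
the mean. -/

noncomputable section

namespace RBCD

/-! ### Step sizes: the recursion and the growth of the weights. -/

section StepSizeLemmas

variable {α κ p τ₀ : ℝ}

lemma tauNext_pos_and_eq {t : ℝ} (hp : 0 < p) (hp1 : p < 1) (ht : 0 < t)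
    (htκ : κ * t < 1) :
    0 < tauNext κ p t ∧
      (1 + t * (1 / p - κ) - κ * t ^ 2) * tauNext κ p t ^ 2
        - t ^ 2 * (1 / p - κ - 1) * tauNext κ p t - t ^ 2 = 0 := by
  obtain ⟨r, hr⟩ : ∃ r, r = 1 / p := ⟨_, rfl⟩
  have hr1 : 1 < r := by rw [hr, lt_div_iff₀ hp]; linarith
  have hpr : (2 - p) / p = 2 * r - 1 := by rw [hr]; field_simp
  unfold tauNext
  rw [hpr, ← hr]
  set E := 1 + t * (r - κ) - κ * t ^ 2 with hE
  have hEpos : 0 < E := by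
    have : E = (1 - κ * t) * (1 + t) + t * (r - 1) := by rw [hE]; ring
    rw [this]
    have h1 : 0 < 1 - κ * t := by linarith
    have h2 : 0 < r - 1 := by linarith
    positivity
  set c := r - κ - 1 with hc
  -- The radicand is the discriminant of the quadratic divided by 4t². Since E > 0 the two roots
  -- have opposite signs, and the closed form is the positive one.
  have hdisc : (1 + (r - κ) * t / 2) ^ 2 - (2 * r - 1 + 2 * κ) * t ^ 2 / 4
      = E + (t / 2 * c) ^ 2 := by
    rw [hE, hc]; ring
  rw [hdisc]
  have hnn : 0 ≤ E + (t / 2 * c) ^ 2 := by positivity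
  set w := √(E + (t / 2 * c) ^ 2) with hw
  have hw2 : w ^ 2 = E + (t / 2 * c) ^ 2 := Real.sq_sqrt hnn
  have habs : |t / 2 * c| < w := by
    rw [hw]
    apply Real.lt_sqrt_of_sq_lt
    rw [sq_abs]; linarith
  have hlt := (abs_lt.1 habs).1
  constructor
  · apply div_pos _ hEpos
    have : t ^ 2 / 2 * c + t * w = t * (w + t / 2 * c) := by ring
    rw [this]
    apply mul_pos ht; linarith
  · have hne := hEpos.ne'
    field_simp
    have : (t ^ 2 * c + 2 * t * w) ^ 2 = t ^ 4 * c ^ 2 + 4 * t ^ 3 * c * w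
        + 4 * t ^ 2 * (E + (t / 2 * c) ^ 2) := by
      rw [← hw2]; ring
    nlinarith [this]

/-- Dividing the quadratic by t²s² gives the product identity, which is the form that chains the
Lyapunov inequalities. Positivity of its right side then propagates κτ < 1. -/
lemma tauNext_spec {t : ℝ} (hp : 0 < p) (hp1 : p < 1) (ht : 0 < t)
    (htκ : κ * t < 1) :
    0 < tauNext κ p t ∧ κ * tauNext κ p t < 1 ∧
      (1 / tauNext κ p t - κ) * (1 / tauNext κ p t + 1 / p - 1) = (1 / t - κ) * (1 / t + 1 / p) := by
  obtain ⟨hs, heq⟩ := tauNext_pos_and_eq hp hp1 ht htκ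
  set s := tauNext κ p t
  have hr1 : 1 < 1 / p := by rw [lt_div_iff₀ hp]; linarith
  set r := 1 / p
  have key : (1 / s - κ) * (1 / s + r - 1) = (1 / t - κ) * (1 / t + r) := by
    field_simp
    linear_combination (-1) * heq
  refine ⟨hs, ?_, key⟩
  have h1 : 0 < 1 / t - κ := by
    rw [sub_pos, lt_div_iff₀ ht]; exact htκ
  have h2 : 0 < (1 / t - κ) * (1 / t + r) := by
    have : 0 < 1 / t := by positivity
    positivity
  rw [← key] at h2
  have h3 : 0 < 1 / s + r - 1 := by
    have : 0 < 1 / s := by positivity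
    linarith
  have h4 := pos_of_mul_pos_left h2 h3.le
  rw [sub_pos, lt_div_iff₀ hs] at h4
  exact h4

lemma tau_pos_and_lt (hp : 0 < p) (hp1 : p < 1) (hτ₀ : 0 < τ₀) (hτκ : κ * τ₀ < 1)
    (k : ℕ) : 0 < tau κ p τ₀ k ∧ κ * tau κ p τ₀ k < 1 := by
  induction k with
  | zero => exact ⟨hτ₀, hτκ⟩
  | succ k ih =>
    have := tauNext_spec hp hp1 ih.1 ih.2
    exact ⟨this.1, this.2.1⟩

/-- The consequences of the step size rules on which the convergence analysis rests. -/
structure StepRules (α κ p : ℝ) (τ σ : ℕ → ℝ) : Prop where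
  α_pos : 0 < α
  p_pos : 0 < p
  p_lt_one : p < 1
  κ_pos : 0 < κ
  τ_pos : ∀ k, 0 < τ k
  σ_pos : ∀ k, 0 < σ k
  σ_eq : ∀ k, σ k = α * (1 / τ k - κ)
  σ_succ : ∀ k, σ (k + 1) * (1 / τ (k + 1) + 1 / p - 1) = σ k * (1 / τ k + 1 / p)
  σ_zero_le : σ 0 ≤ p

lemma stepRules {β : ℝ} {τ σ : ℕ → ℝ} (hα : 0 < α) (hp : 0 < p) (hp1 : p < 1) (hκ : 0 < κ)
    (hβ : β = α * κ) (hτ₀ : 0 < τ₀) (hτκ : τ₀ < 1 / κ) (hτ : τ = tau κ p τ₀)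
    (hσ : σ = sigma α β τ) (hσ₀ : σ 0 ≤ p) : StepRules α κ p τ σ := by
  have hτκ' : κ * τ₀ < 1 := by
    rw [lt_div_iff₀ hκ] at hτκ; linarith
  have hpos := tau_pos_and_lt hp hp1 hτ₀ hτκ'
  have hσe : ∀ k, σ k = α * (1 / τ k - κ) := by
    intro k
    have := (hpos k).1
    rw [hσ, sigma, hβ, hτ]
    field_simp
  refine ⟨hα, hp, hp1, hκ, fun k => hτ ▸ (hpos k).1, fun k => ?_, hσe, fun k => ?_, hσ₀⟩
  · rw [hσe, hτ]
    apply mul_pos hα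
    rw [sub_pos, lt_div_iff₀ (hpos k).1]
    exact (hpos k).2
  · have := (tauNext_spec hp hp1 (hpos k).1 (hpos k).2).2.2
    rw [hσe, hσe, mul_assoc, mul_assoc, hτ]
    congr 1

namespace StepRules

variable {τ σ : ℕ → ℝ} (hS : StepRules α κ p τ σ)
include hS

lemma one_lt_inv : 1 < 1 / p := by
  rw [lt_div_iff₀ hS.p_pos]; linarith [hS.p_lt_one]

/-- Substituting 1/τ = σ/α + κ eliminates τ, so that growth can be studied on σ alone. -/
lemma recursion (k : ℕ) : σ (k + 1) * (σ (k + 1) + α * (κ + 1 / p - 1))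
    = σ k * (σ k + α * (κ + 1 / p)) := by
  have e := hS.σ_succ k
  have h1 : ∀ k, α * (1 / τ k) = σ k + α * κ := fun k => by rw [hS.σ_eq]; ring
  have : α * (σ (k + 1) * (1 / τ (k + 1) + 1 / p - 1)) = α * (σ k * (1 / τ k + 1 / p)) := by rw [e]
  have a1 := h1 k
  have a2 := h1 (k + 1)
  linear_combination this - σ (k + 1) * a2 + σ k * a1

/-- The map s ↦ s(s + α(κ + 1/p)) increases on s > 0, and at (1-p)σ_{k+1} it does not exceed its
value at σ_k. This bound is what keeps w^k a convex combination of the x^j. -/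
lemma one_sub_mul_le (k : ℕ) : (1 - p) * σ (k + 1) ≤ σ k := by
  have e := hS.recursion k
  have h1 := hS.σ_pos k
  have h2 := hS.σ_pos (k + 1)
  have hp := hS.p_pos
  have hp1 := hS.p_lt_one
  have hα := hS.α_pos
  have hκ := hS.κ_pos
  have hr := hS.one_lt_inv
  by_contra! hlt
  set b := (1 - p) * σ (k + 1) with hb
  have hq : 0 < 1 - p := by linarith
  have hbpos : 0 < b := by positivity
  have h3 : σ k * (σ k + α * (κ + 1 / p)) < b * (b + α * (κ + 1 / p)) := by
    have : 0 < α * (κ + 1 / p) := by positivity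
    gcongr
  have h4 : b * (b + α * (κ + 1 / p)) ≤ σ (k + 1) * (σ (k + 1) + α * (κ + 1 / p - 1)) := by
    have h5 : (1 - p) * (κ + 1 / p) ≤ κ + 1 / p - 1 := by
      have : p * (1 / p) = 1 := by field_simp
      nlinarith
    have h6 : (1 - p) * b ≤ σ (k + 1) := by
      rw [hb]; nlinarith
    have h7 : (1 - p) * (b + α * (κ + 1 / p)) ≤ σ (k + 1) + α * (κ + 1 / p - 1) := by
      nlinarith
    calc b * (b + α * (κ + 1 / p)) = σ (k + 1) * ((1 - p) * (b + α * (κ + 1 / p))) := by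
          rw [hb]; ring
      _ ≤ _ := by gcongr
  linarith

lemma exists_increment : ∃ c, 0 < c ∧ ∀ k : ℕ, c * ((k : ℝ) + 1) ≤ σ k := by
  have hα := hS.α_pos
  have hκ := hS.κ_pos
  have hr := hS.one_lt_inv
  have hrp : 0 < 1 / p := by linarith
  have hσ0 := hS.σ_pos 0
  set K := α * (κ + 1 / p) with hK
  have hKpos : 0 < K := by positivity
  have hmono : ∀ k, σ k ≤ σ (k + 1) := by
    intro k
    have e := hS.recursion k
    have h1 := hS.σ_pos k
    have h2 := hS.σ_pos (k + 1)
    by_contra! h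
    have : σ (k + 1) * (σ (k + 1) + α * (κ + 1 / p - 1)) < σ k * (σ k + α * (κ + 1 / p)) := by
      have h3 : 0 < κ + 1 / p - 1 := by linarith
      have : 0 < α * (κ + 1 / p - 1) := by positivity
      have h4 : α * (κ + 1 / p - 1) ≤ α * (κ + 1 / p) := by nlinarith
      nlinarith
    linarith
  have hge : ∀ k, σ 0 ≤ σ k := fun k => monotone_nat_of_le_succ hmono (Nat.zero_le k)
  -- The recursion reads (σ_{k+1} - σ_k)(σ_{k+1} + σ_k + K) = ασ_{k+1}. By monotonicity the
  -- increment is at least ασ_{k+1}/(2σ_{k+1} + K), which increases in σ_{k+1} ≥ σ_0. The first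
  -- entry of the minimum serves k = 0.
  set c := min (σ 0) (α * σ 0 / (2 * σ 0 + K)) with hc
  have hcpos : 0 < c := by
    rw [hc]; positivity
  refine ⟨c, hcpos, fun k => ?_⟩
  induction k with
  | zero => simp [hc]
  | succ k ih =>
    have e := hS.recursion k
    have e' : (σ (k + 1) - σ k) * (σ (k + 1) + σ k + K) = α * σ (k + 1) := by
      rw [hK]; linear_combination e
    have h1 := hS.σ_pos k
    have h2 := hS.σ_pos (k + 1)
    have hc2 : c * (2 * σ 0 + K) ≤ α * σ 0 := by
      rw [← le_div_iff₀ (by positivity)]; exact min_le_right _ _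
    have h3 : c ≤ σ (k + 1) - σ k := by
      by_contra! h
      have h4 : (σ (k + 1) - σ k) * (σ (k + 1) + σ k + K) < c * (2 * σ (k + 1) + K) := by
        have : σ (k + 1) + σ k + K ≤ 2 * σ (k + 1) + K := by linarith [hmono k]
        calc _ < c * (σ (k + 1) + σ k + K) := by gcongr
          _ ≤ _ := by gcongr
      have h5 : c * (2 * σ (k + 1) + K) ≤ α * σ (k + 1) := by
        have h6 := hge (k + 1)
        have h7 : c * 2 ≤ α := by
          by_contra! h8
          nlinarith
        nlinarith
      linarith
    push_cast
    linarith

lemma weight_pos (k : ℕ) : 0 < weight σ k := by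
  induction k with
  | zero => simp [weight]
  | succ k ih => rw [weight]; linarith [hS.σ_pos (k + 1)]

lemma σ_le (k : ℕ) : σ k ≤ p * weight σ k := by
  induction k with
  | zero => simpa [weight] using hS.σ_zero_le
  | succ k ih =>
    have := hS.one_sub_mul_le k
    rw [weight]; linarith

/-- Quadratic growth of the weights; `weight σ k - σ k` is `S_{k-1}` for `k ≥ 1`. -/
lemma exists_sq_le : ∃ c, 0 < c ∧ ∀ k : ℕ, c * (k : ℝ) ^ 2 ≤ weight σ k - σ k ∧
    c * (k : ℝ) ^ 2 ≤ σ k ^ 2 ∧ c * (k : ℝ) ^ 2 ≤ σ k * (1 / τ k + 1 / p - 1) := by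
  obtain ⟨c, hc, hσ⟩ := hS.exists_increment
  have hα := hS.α_pos
  have hr := hS.one_lt_inv
  -- The factor `max 1 c` is there for the base case, where S_0 = 1 is unrelated to c.
  have hsum : ∀ k : ℕ, c / 2 * ((k : ℝ) + 1) ^ 2 ≤ max 1 c * weight σ k := by
    intro k
    have hm1 : 1 ≤ max 1 c := le_max_left _ _
    have hm2 : c ≤ max 1 c := le_max_right _ _
    induction k with
    | zero => simp only [weight]; push_cast; nlinarith
    | succ k ih =>
      have h1 := hσ (k + 1)
      have h2 := hS.σ_pos (k + 1)
      have : c * ((k : ℝ) + 2) ≤ max 1 c * σ (k + 1) := by push_cast at h1; nlinarith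
      rw [weight]; push_cast; nlinarith
  have hm : 0 < max 1 c := by positivity
  refine ⟨min (c / 2 / max 1 c) (min (c ^ 2) (c ^ 2 / α)), by positivity, fun k => ⟨?_, ?_, ?_⟩⟩
  · have hmin : min (c / 2 / max 1 c) (min (c ^ 2) (c ^ 2 / α)) ≤ c / 2 / max 1 c := min_le_left _ _
    cases k with
    | zero =>
      have := hS.σ_zero_le
      have := hS.p_lt_one
      simp only [weight]; norm_num; linarith
    | succ k =>
      have h1 := hsum k
      rw [weight, add_sub_cancel_right]
      push_cast
      calc _ ≤ c / 2 / max 1 c * ((k : ℝ) + 1) ^ 2 := by gcongr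
        _ ≤ _ := by rw [div_mul_eq_mul_div, div_le_iff₀ hm]; linarith
  · have hmin : min (c / 2 / max 1 c) (min (c ^ 2) (c ^ 2 / α)) ≤ c ^ 2 :=
      (min_le_right _ _).trans (min_le_left _ _)
    calc _ ≤ c ^ 2 * (k : ℝ) ^ 2 := by gcongr
      _ = (c * k) ^ 2 := by ring
      _ ≤ _ := by
        have := hσ k
        gcongr
        linarith
  · have hmin : min (c / 2 / max 1 c) (min (c ^ 2) (c ^ 2 / α)) ≤ c ^ 2 / α :=
      (min_le_right _ _).trans (min_le_right _ _)
    have h0 := hS.σ_pos k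
    have hτ : σ k / α ≤ 1 / τ k := by
      rw [hS.σ_eq, mul_div_cancel_left₀ _ hα.ne']; linarith [hS.κ_pos]
    calc _ ≤ c ^ 2 / α * (k : ℝ) ^ 2 := by gcongr
      _ = (c * k) ^ 2 / α := by ring
      _ ≤ σ k ^ 2 / α := by
        have := hσ k
        gcongr
        linarith
      _ = σ k * (σ k / α) := by ring
      _ ≤ _ := by gcongr; linarith

end StepRules

end StepSizeLemmas

/-! ### Strong convexity at a minimiser. -/

section StrongConvexity

variable {E : Type*} [NormedAddCommGroup E]

lemma strongConvexOn_add_sq_norm_le [NormedSpace ℝ E] {s : Set E} {c : ℝ} {f : E → ℝ}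
    (hf : StrongConvexOn s c f) (hc : 0 ≤ c) {v : E} (hv : v ∈ s) (hmin : ∀ u ∈ s, f v ≤ f u)
    {u : E} (hu : u ∈ s) : f v + c / 2 * ‖u - v‖ ^ 2 ≤ f u := by
  have key : ∀ t : ℝ, 0 < t → t < 1 → (1 - t) * (c / 2 * ‖u - v‖ ^ 2) ≤ f u - f v := by
    intro t ht ht1
    have h := hf.2 hu hv ht.le (by linarith : 0 ≤ 1 - t) (by ring)
    have hm := hmin _ (hf.1 hu hv ht.le (by linarith : 0 ≤ 1 - t) (by ring))
    simp only [smul_eq_mul] at h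
    have : t * ((1 - t) * (c / 2 * ‖u - v‖ ^ 2)) ≤ t * (f u - f v) := by nlinarith
    exact le_of_mul_le_mul_left this ht
  have hC : 0 ≤ c / 2 * ‖u - v‖ ^ 2 := by positivity
  have hD := hmin u hu
  by_contra! hlt
  set C := c / 2 * ‖u - v‖ ^ 2
  have hCpos : 0 < C := by linarith
  -- This t makes (1-t)C the midpoint of C and f u - f v, which contradicts `key` without a passage
  -- to the limit t → 0.
  have h := key ((C - (f u - f v)) / (2 * C)) (div_pos (by linarith) (by linarith))
    (by rw [div_lt_one (by linarith)]; linarith)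
  have : (1 - (C - (f u - f v)) / (2 * C)) * C = (C + (f u - f v)) / 2 := by
    field_simp; ring
  linarith

variable [InnerProductSpace ℝ E]

lemma norm_sq_convex_comb_sub (u v y : E) {a b : ℝ} (hab : a + b = 1) :
    ‖a • u + b • v - y‖ ^ 2 = a * ‖u - y‖ ^ 2 + b * ‖v - y‖ ^ 2 - a * b * ‖u - v‖ ^ 2 := by
  have e1 : a • u + b • v - y = a • (u - y) + b • (v - y) := by
    have : y = (a + b) • y := by rw [hab, one_smul]
    nth_rw 1 [this]
    module
  have e2 : u - v = (u - y) - (v - y) := by abel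
  rw [e1, e2]
  generalize u - y = p
  generalize v - y = q
  rw [norm_add_sq_real, norm_sub_sq_real, norm_smul, norm_smul, mul_pow, mul_pow, Real.norm_eq_abs,
    Real.norm_eq_abs, sq_abs, sq_abs, real_inner_smul_left, real_inner_smul_right]
  obtain rfl : b = 1 - a := by linarith
  ring

lemma strongConvexOn_add_inner_add_sq {s : Set E} {c : ℝ} {f : E → ℝ} (hf : StrongConvexOn s c f)
    (g y : E) (q : ℝ) :
    StrongConvexOn s (c + q) fun u => f u + (inner ℝ g (u - y) + 1 / 2 * (q * ‖u - y‖ ^ 2)) := by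
  refine ⟨hf.1, fun u hu v hv a b ha hb hab => ?_⟩
  have h := hf.2 hu hv ha hb hab
  simp only [smul_eq_mul] at h ⊢
  rw [norm_sq_convex_comb_sub u v y hab]
  have e1 : a • u + b • v - y = a • (u - y) + b • (v - y) := by
    have : y = (a + b) • y := by rw [hab, one_smul]
    nth_rw 1 [this]
    module
  rw [e1, inner_add_right, real_inner_smul_right, real_inner_smul_right]
  nlinarith

end StrongConvexity

/-! ### Existence of the forward-backward step and its three-point inequality. -/

section Minimizers

variable {E : Type*} [NormedAddCommGroup E] [InnerProductSpace ℝ E] [FiniteDimensional ℝ E]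

/-- Lower semicontinuity bounds r below on the unit ball around u₀; convexity along the segment from
u₀ to u, which crosses the unit sphere, extends the bound with linear loss. -/
lemma exists_norm_lower_bound {r : E → EReal} (hbot : ∀ x, r x ≠ ⊥) (hlsc : LowerSemicontinuous r)
    (hconv : ConvexOn ℝ {x | r x ≠ ⊤} fun x => (r x).toReal) {u₀ : E} (hu₀ : r u₀ ≠ ⊤) :
    ∃ K, 0 ≤ K ∧ ∀ u, r u ≠ ⊤ → (r u₀).toReal - K * (‖u - u₀‖ + 1) ≤ (r u).toReal := by
  obtain ⟨a, -, ha⟩ := LowerSemicontinuousOn.exists_isMinOn (f := r)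
    ⟨u₀, Metric.mem_closedBall_self zero_le_one⟩ (isCompact_closedBall u₀ 1)
    (hlsc.lowerSemicontinuousOn _)
  have hau : r a ≤ r u₀ := ha (Metric.mem_closedBall_self zero_le_one)
  have hle : ∀ v, r v ≠ ⊤ → ‖v - u₀‖ ≤ 1 → (r a).toReal ≤ (r v).toReal := fun v hv hv1 =>
    EReal.toReal_le_toReal (ha (by rwa [Metric.mem_closedBall, dist_eq_norm])) (hbot a) hv
  have hle₀ := hle u₀ hu₀ (by simp)
  refine ⟨(r u₀).toReal - (r a).toReal, by linarith, fun u hu => ?_⟩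
  rcases le_or_gt ‖u - u₀‖ 1 with h | h
  · have := hle u hu h
    nlinarith [norm_nonneg (u - u₀)]
  · set s := ‖u - u₀‖ with hs
    have hs0 : 0 < s := by linarith
    have hinv : s⁻¹ ≤ 1 := inv_le_one_of_one_le₀ h.le
    have hc := hconv.2 hu hu₀ (inv_nonneg.2 hs0.le) (sub_nonneg.2 hinv) (by ring)
    have hm := hconv.1 hu hu₀ (inv_nonneg.2 hs0.le) (sub_nonneg.2 hinv) (by ring)
    have hn : ‖s⁻¹ • u + (1 - s⁻¹) • u₀ - u₀‖ ≤ 1 := by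
      have : s⁻¹ • u + (1 - s⁻¹) • u₀ - u₀ = s⁻¹ • (u - u₀) := by module
      rw [this, norm_smul, norm_inv, Real.norm_eq_abs, abs_of_pos hs0, ← hs, inv_mul_cancel₀ hs0.ne']
    have h1 := (hle _ hm hn).trans hc
    simp only [smul_eq_mul] at h1
    have h2 : s * (r a).toReal ≤ s * (s⁻¹ * (r u).toReal + (1 - s⁻¹) * (r u₀).toReal) := by gcongr
    have h3 : s * (s⁻¹ * (r u).toReal + (1 - s⁻¹) * (r u₀).toReal)
        = (r u).toReal + (s - 1) * (r u₀).toReal := by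
      field_simp
    nlinarith

lemma exists_forall_add_quadratic_le {r : E → EReal} (hbot : ∀ x, r x ≠ ⊥)
    (hlsc : LowerSemicontinuous r) (hconv : ConvexOn ℝ {x | r x ≠ ⊤} fun x => (r x).toReal)
    {u₀ : E} (hu₀ : r u₀ ≠ ⊤) (g y : E) {c : ℝ} (hc : 0 < c) :
    ∃ v, ∀ u, r v + ((inner ℝ g (v - y) + 1 / 2 * (c * ‖v - y‖ ^ 2) : ℝ) : EReal)
      ≤ r u + ((inner ℝ g (u - y) + 1 / 2 * (c * ‖u - y‖ ^ 2) : ℝ) : EReal) := by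
  obtain ⟨K, hK, hbd⟩ := exists_norm_lower_bound hbot hlsc hconv hu₀
  set Q : E → ℝ := fun u => inner ℝ g (u - y) + 1 / 2 * (c * ‖u - y‖ ^ 2) with hQ
  have hQc : Continuous Q := by fun_prop
  have hF : LowerSemicontinuous fun u => r u + (Q u : EReal) := by
    apply LowerSemicontinuous.add' hlsc
    · exact (continuous_coe_real_ereal.comp hQc).lowerSemicontinuous
    · intro x
      exact EReal.continuousAt_add (Or.inr (EReal.coe_ne_bot _)) (Or.inr (EReal.coe_ne_top _))
  set C := |Q u₀ + K * (‖u₀ - y‖ + 1)| with hC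
  -- Beyond this radius the quadratic term dominates the linear terms and the constant C, so a
  -- minimiser over the ball is global. Radius at least 1 lets C be absorbed into C·n, and radius at
  -- least ‖u₀ - y‖ puts u₀ in the ball.
  set B := max (max 1 ‖u₀ - y‖) (2 * (K + ‖g‖ + C) / c) with hB
  have hu₀B : u₀ ∈ Metric.closedBall y B := by
    rw [Metric.mem_closedBall, dist_eq_norm]
    exact (le_max_right _ _).trans (le_max_left _ _)
  obtain ⟨v, -, hv⟩ := LowerSemicontinuousOn.exists_isMinOn ⟨u₀, hu₀B⟩ (isCompact_closedBall y B)
    (hF.lowerSemicontinuousOn _)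
  refine ⟨v, fun u => ?_⟩
  by_cases huB : u ∈ Metric.closedBall y B
  · exact hv huB
  refine (hv hu₀B).trans ?_
  by_cases hut : r u = ⊤
  · rw [hut, EReal.top_add_coe]; exact le_top
  change r u₀ + (Q u₀ : EReal) ≤ r u + (Q u : EReal)
  rw [← EReal.coe_toReal hu₀ (hbot _), ← EReal.coe_toReal hut (hbot _)]
  norm_cast
  rw [Metric.mem_closedBall, dist_eq_norm, not_le] at huB
  have h1 := hbd u hut
  set n := ‖u - y‖ with hn
  have hn1 : 1 < n := ((le_max_left _ _).trans (le_max_left _ _)).trans_lt huB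
  have hn2 : 2 * (K + ‖g‖ + C) / c < n := (le_max_right _ _).trans_lt huB
  rw [div_lt_iff₀ hc] at hn2
  have hn3 : ‖u - u₀‖ ≤ n + ‖u₀ - y‖ := by
    have : u - u₀ = (u - y) - (u₀ - y) := by abel
    rw [this]; exact norm_sub_le _ _
  have hg : -(‖g‖ * n) ≤ inner ℝ g (u - y) := by
    have := abs_real_inner_le_norm g (u - y)
    exact (abs_le.1 this).1
  have hC' : Q u₀ + K * (‖u₀ - y‖ + 1) ≤ C := le_abs_self _
  have hC0 : 0 ≤ C := abs_nonneg _
  have hQu : Q u = inner ℝ g (u - y) + 1 / 2 * (c * n ^ 2) := rfl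
  have h4 : (K + ‖g‖ + C) * n ≤ 1 / 2 * (c * n ^ 2) := by nlinarith
  have h5 : K * (‖u - u₀‖ + 1) ≤ K * (n + ‖u₀ - y‖ + 1) := by gcongr
  nlinarith

end Minimizers

namespace Data.Regular

variable {d q : ℕ} {m : Fin d → ℕ} {D : Data d q m} (hD : D.Regular)
include hD

lemma FB_isMin (i : Fin d) (g y : Blk m i) {c : ℝ} (hc : 0 < c) (u : Blk m i) :
    fbObj D i g y c (FB D i g y c) ≤ fbObj D i g y c u := by
  obtain ⟨u₀, hu₀⟩ := hD.proper i
  have hconv : ConvexOn ℝ {x | D.r i x ≠ ⊤} fun x => (D.r i x).toReal :=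
    strongConvexOn_zero.1 ((hD.strongConvex i).mono (hD.μ_pos i).le)
  exact Classical.epsilon_spec (p := fun v => ∀ u, fbObj D i g y c v ≤ fbObj D i g y c u)
    (exists_forall_add_quadratic_le (hD.ne_bot i) (hD.lsc i) hconv hu₀ g y hc) u

lemma r_FB_ne_top (i : Fin d) (g y : Blk m i) {c : ℝ} (hc : 0 < c) :
    D.r i (FB D i g y c) ≠ ⊤ := by
  obtain ⟨u₀, hu₀⟩ := hD.proper i
  intro htop
  have h := hD.FB_isMin i g y hc u₀
  unfold fbObj at h
  rw [htop, EReal.top_add_coe, top_le_iff] at h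
  exact EReal.add_ne_top hu₀ (EReal.coe_ne_top _) h

/-- The step minimises a function that is strongly convex with modulus μ_i + c, hence the quadratic
growth around it. -/
lemma FB_three_point (i : Fin d) (g y : Blk m i) {c : ℝ} (hc : 0 < c) {u : Blk m i}
    (hu : D.r i u ≠ ⊤) :
    (D.r i (FB D i g y c)).toReal + inner ℝ g (FB D i g y c - u)
        + c / 2 * ‖FB D i g y c - y‖ ^ 2 + (D.μ i + c) / 2 * ‖FB D i g y c - u‖ ^ 2
      ≤ (D.r i u).toReal + c / 2 * ‖y - u‖ ^ 2 := by
  set v := FB D i g y c with hv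
  have hvt := hD.r_FB_ne_top i g y hc
  have h := strongConvexOn_add_sq_norm_le
    (strongConvexOn_add_inner_add_sq (hD.strongConvex i) g y c)
    (by linarith [hD.μ_pos i]) (v := v) hvt (fun w hw => ?_) (u := u) hu
  · rw [norm_sub_rev v u, norm_sub_rev y u]
    have e : (inner ℝ g (v - u) : ℝ) = inner ℝ g (v - y) - inner ℝ g (u - y) := by
      rw [← inner_sub_right]; congr 1; abel
    rw [e]
    linarith
  · have h := hD.FB_isMin i g y hc w
    unfold fbObj at h
    rw [← hv, ← EReal.coe_toReal hvt (hD.ne_bot _ _), ← EReal.coe_toReal hw (hD.ne_bot _ _)] at h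
    exact_mod_cast h

end Data.Regular

/-- The spectrum of λ_max I - M is the reflected spectrum of M, hence nonnegative. -/
lemma dotProduct_mulVec_le_lamMax {n : Type*} [Fintype n] [DecidableEq n] {M : Matrix n n ℝ}
    (hM : M.IsHermitian) (v : n → ℝ) : v ⬝ᵥ M *ᵥ v ≤ lamMax M * (v ⬝ᵥ v) := by
  have hpsd : (algebraMap ℝ (Matrix n n ℝ) (lamMax M) - M).PosSemidef := by
    rw [Matrix.posSemidef_iff_isHermitian_and_spectrum_nonneg]
    refine ⟨?_, ?_⟩
    · refine Matrix.IsHermitian.sub ?_ hM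
      rw [Matrix.algebraMap_eq_diagonal]
      exact Matrix.isHermitian_diagonal _
    · rw [← spectrum.singleton_sub_eq]
      rintro _ ⟨a, ha, c, hc, rfl⟩
      rw [Set.mem_singleton_iff] at ha
      simp only [ha, Set.mem_ofPred_eq, sub_nonneg]
      exact le_csSup Matrix.finite_real_spectrum.bddAbove hc
  have h := hpsd.dotProduct_mulVec_nonneg v
  rw [star_trivial, Matrix.sub_mulVec, dotProduct_sub, Algebra.algebraMap_eq_smul_one,
    Matrix.smul_mulVec, Matrix.one_mulVec, dotProduct_smul, smul_eq_mul] at h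
  linarith

/-! ### Block calculus and the quadratic h. -/

section Blocks

variable {d : ℕ} {m : Fin d → ℕ}

/-- The vector with the blocks outside `I` set to zero. -/
def mask (I : Finset (Fin d)) (v : Vec m) : Vec m :=
  WithLp.toLp 2 fun a => if a.1 ∈ I then v a else 0

/-- The squared norm with weight `c i` on block `i`. -/
def wnorm (c : Fin d → ℝ) (v : Vec m) : ℝ := ∑ i, c i * ‖blk i v‖ ^ 2

@[simp] lemma blk_apply (i : Fin d) (v : Vec m) (j : Fin (m i)) : blk i v j = v ⟨i, j⟩ := rfl

@[simp] lemma blk_add (i : Fin d) (v w : Vec m) : blk i (v + w) = blk i v + blk i w := rfl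

@[simp] lemma blk_sub (i : Fin d) (v w : Vec m) : blk i (v - w) = blk i v - blk i w := rfl

@[simp] lemma blk_smul (i : Fin d) (c : ℝ) (v : Vec m) : blk i (c • v) = c • blk i v := rfl

@[simp] lemma blk_ofBlks (i : Fin d) (y : ∀ i, Blk m i) : blk i (ofBlks y) = y i := rfl

lemma ext_blk {v w : Vec m} (h : ∀ i, blk i v = blk i w) : v = w := by
  ext ⟨i, j⟩
  exact congrArg (fun u : Blk m i => u j) (h i)

lemma blk_mask (I : Finset (Fin d)) (v : Vec m) (i : Fin d) :
    blk i (mask I v) = if i ∈ I then blk i v else 0 := by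
  ext j
  by_cases h : i ∈ I <;> simp [mask, h]

lemma inner_eq_sum_blk (v w : Vec m) : (inner ℝ v w : ℝ) = ∑ i, inner ℝ (blk i v) (blk i w) := by
  simp only [PiLp.inner_apply]
  rw [Fintype.sum_sigma]
  rfl

lemma norm_sq_eq_sum_blk (v : Vec m) : ‖v‖ ^ 2 = ∑ i, ‖blk i v‖ ^ 2 := by
  simp only [← real_inner_self_eq_norm_sq]
  exact inner_eq_sum_blk v v

lemma wnorm_eq (c : Fin d → ℝ) (v : Vec m) : wnorm c v = ∑ a : Σ i, Fin (m i), c a.1 * v a ^ 2 := by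
  rw [wnorm, Fintype.sum_sigma]
  refine Finset.sum_congr rfl fun i _ => ?_
  rw [EuclideanSpace.real_norm_sq_eq, Finset.mul_sum]
  rfl

end Blocks

namespace Data

variable {d q : ℕ} {m : Fin d → ℕ} (D : Data d q m)

/-- Multiplication by `A` as a continuous linear map. -/
def opA : Vec m →L[ℝ] EuclideanSpace ℝ (Fin q) :=
  LinearMap.toContinuousLinearMap (Matrix.toEuclideanLin D.A)

lemma h_eq (x : Vec m) : D.h x = 1 / 2 * ‖D.opA x - D.b‖ ^ 2 := rfl

lemma inner_gradient_h (z y : Vec m) :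
    (inner ℝ (∇ D.h z) y : ℝ) = inner ℝ (D.opA z - D.b) (D.opA y) := by
  have h1 : HasFDerivAt (fun x => D.opA x - D.b) D.opA z := D.opA.hasFDerivAt.sub_const _
  have h2 := (h1.norm_sq).const_mul (1 / 2 : ℝ)
  have h3 : fderiv ℝ D.h z = _ := h2.fderiv
  rw [gradient, InnerProductSpace.toDual_symm_apply, h3]
  simp [inner_sub_left]

lemma h_add (z y : Vec m) :
    D.h (z + y) = D.h z + inner ℝ (∇ D.h z) y + 1 / 2 * ‖D.opA y‖ ^ 2 := by
  rw [inner_gradient_h, h_eq, h_eq, map_add]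
  have : D.opA z + D.opA y - D.b = (D.opA z - D.b) + D.opA y := by abel
  rw [this, norm_add_sq_real]
  ring

lemma inner_transpose_mul_mulVec (y v : Vec m) :
    (inner ℝ (WithLp.toLp 2 ((D.Aᵀ * D.A) *ᵥ y.ofLp) : Vec m) v : ℝ)
      = inner ℝ (D.opA y) (D.opA v) := by
  change (v.ofLp ⬝ᵥ (D.Aᵀ * D.A) *ᵥ y.ofLp : ℝ) = (D.A *ᵥ v.ofLp) ⬝ᵥ (D.A *ᵥ y.ofLp)
  rw [← Matrix.mulVec_mulVec, Matrix.dotProduct_mulVec, Matrix.vecMul_transpose]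

lemma inner_opA_sub_b_eq_zero {x : Vec m} (hx : (D.Aᵀ * D.A) *ᵥ x.ofLp - D.Aᵀ *ᵥ D.b.ofLp = 0)
    (v : Vec m) : (inner ℝ (D.opA x - D.b) (D.opA v) : ℝ) = 0 := by
  change ((D.A *ᵥ v.ofLp) ⬝ᵥ (D.A *ᵥ x.ofLp - D.b.ofLp) : ℝ) = 0
  rw [← Matrix.vecMul_transpose, ← Matrix.dotProduct_mulVec, Matrix.mulVec_sub,
    Matrix.mulVec_mulVec, hx, dotProduct_zero]

lemma h_eq_of_normal {x : Vec m} (hx : (D.Aᵀ * D.A) *ᵥ x.ofLp - D.Aᵀ *ᵥ D.b.ofLp = 0)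
    (u : Vec m) : D.h u = D.h x + 1 / 2 * ‖D.opA (u - x)‖ ^ 2 := by
  have := D.h_add x (u - x)
  rw [inner_gradient_h, D.inner_opA_sub_b_eq_zero hx, add_zero, add_sub_cancel] at this
  exact this

end Data

/-! ### Spectral meaning of α and κ. -/

section Spectral

variable {d q : ℕ} {m : Fin d → ℕ} {D : Data d q m}

/-- The matrix is diagonal with entries (L_i + μ_i)/(pμ_i); testing with a unit vector of block i
reads off one of them. An empty block contributes no entry, so the block must have positive
dimension. -/
lemma le_kappa_mul (hD : D.Regular) {p : ℝ} (hp : 0 < p) {i : Fin d} (hi : 0 < m i) :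
    D.L i + D.μ i ≤ kappa D p * (p * D.μ i) := by
  have e : Mrt D p * (D.Lam + D.Ups) * Mrt D p
      = Matrix.diagonal fun a : Σ i, Fin (m i) => (D.L a.1 + D.μ a.1) / (p * D.μ a.1) := by
    rw [Mrt, Data.Lam, Data.Ups, Matrix.diagonal_add, Matrix.diagonal_mul_diagonal,
      Matrix.diagonal_mul_diagonal]
    congr 1
    ext a
    have hpos : 0 < p * D.μ a.1 := mul_pos hp (hD.μ_pos _)
    have : √(p * D.μ a.1) * √(p * D.μ a.1) = p * D.μ a.1 := Real.mul_self_sqrt hpos.le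
    have hs : 0 < √(p * D.μ a.1) := Real.sqrt_pos.2 hpos
    rw [div_mul_eq_mul_div, one_mul, div_mul_div_comm, mul_one, this]
  have hpos : 0 < p * D.μ i := mul_pos hp (hD.μ_pos _)
  have h := dotProduct_mulVec_le_lamMax (M := Mrt D p * (D.Lam + D.Ups) * Mrt D p)
    (by rw [e]; exact Matrix.isHermitian_diagonal _) (Pi.single ⟨i, ⟨0, hi⟩⟩ 1)
  change _ ≤ kappa D p * _ at h
  rw [e, Matrix.mulVec_single_one, single_one_dotProduct, single_one_dotProduct] at h
  simp only [Matrix.col_apply, Matrix.diagonal_apply_eq, Pi.single_eq_same, mul_one] at h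
  rwa [div_le_iff₀ hpos] at h

/-- The law of a random set of blocks that contains every block with probability `p`. -/
structure IsUniformLaw {d : ℕ} (Q : Finset (Fin d) → ℝ) (p : ℝ) : Prop where
  nonneg : ∀ I, 0 ≤ Q I
  sum_eq_one : ∑ I, Q I = 1
  sum_mem : ∀ i, (∑ I, if i ∈ I then Q I else 0) = p

variable {Ω : Type*} [MeasurableSpace Ω] {Pr : Measure Ω} [IsProbabilityMeasure Pr]

lemma integral_comp_finset {J : Ω → Finset (Fin d)} (hJ : Measurable J)
    (f : Finset (Fin d) → ℝ) : ∫ ω, f (J ω) ∂Pr = ∑ I, (Pr.map J).real {I} * f I := by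
  have : IsProbabilityMeasure (Pr.map J) := Measure.isProbabilityMeasure_map hJ.aemeasurable
  rw [← integral_map hJ.aemeasurable (measurable_of_countable f).aestronglyMeasurable,
    integral_fintype Integrable.of_finite]
  rfl

lemma isUniformLaw {J : Ω → Finset (Fin d)} (hJ : Measurable J) {p : ℝ}
    (hu : ∀ i, Pr.real {ω | i ∈ J ω} = p) : IsUniformLaw (fun I => (Pr.map J).real {I}) p := by
  refine ⟨fun I => measureReal_nonneg, ?_, fun i => ?_⟩
  · have := integral_comp_finset (Pr := Pr) hJ fun _ => 1
    simpa using this.symm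
  · have h := integral_comp_finset (Pr := Pr) hJ fun I => if i ∈ I then 1 else 0
    have hs : MeasurableSet {ω | i ∈ J ω} := hJ (measurableSet_mem_finset i)
    have : (fun ω => if i ∈ J ω then (1 : ℝ) else 0) = Set.indicator {ω | i ∈ J ω} 1 := by
      ext ω; simp [Set.indicator_apply]
    rw [this, integral_indicator_one hs, hu] at h
    rw [h]
    simp

lemma dotProduct_Xi {J : Ω → Finset (Fin d)} (hJ : Measurable J) (p : ℝ) (v : Vec m) :
    v.ofLp ⬝ᵥ Xi D Pr J p *ᵥ v.ofLp
      = ∑ I, (Pr.map J).real {I} * ((1 / p) ^ 2 * ‖D.opA (mask I v)‖ ^ 2) := by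
  have hXi : Xi D Pr J p = ∑ I, (Pr.map J).real {I} •
      (actMat m I * Pmat m p * D.Aᵀ * D.A * Pmat m p * actMat m I) := by
    ext a c
    rw [Xi, Matrix.of_apply, integral_comp_finset hJ
      fun I => (actMat m I * Pmat m p * D.Aᵀ * D.A * Pmat m p * actMat m I) a c,
      Matrix.sum_apply]
    rfl
  rw [hXi, Matrix.sum_mulVec, dotProduct_sum]
  refine Finset.sum_congr rfl fun I _ => ?_
  rw [Matrix.smul_mulVec, dotProduct_smul, smul_eq_mul]
  congr 1
  have e1 : actMat m I *ᵥ v.ofLp = (mask I v).ofLp := by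
    ext a; simp [actMat, Matrix.mulVec_diagonal, mask]
  have e2 : ∀ u : (Σ i, Fin (m i)) → ℝ, Pmat m p *ᵥ u = (1 / p) • u := by
    intro u; ext a; simp [Pmat, Matrix.mulVec_diagonal]
  have e3 : v.ofLp ᵥ* actMat m I = (mask I v).ofLp := by
    ext a; simp [actMat, Matrix.vecMul_diagonal, mask]
  simp only [← Matrix.mulVec_mulVec, Matrix.mul_assoc]
  rw [e1, Matrix.dotProduct_mulVec, e3, e2, e2, Matrix.mulVec_smul, Matrix.mulVec_smul,
    dotProduct_smul, dotProduct_smul, Matrix.dotProduct_mulVec, Matrix.vecMul_transpose,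
    ← real_inner_self_eq_norm_sq]
  change _ = (1 / p) ^ 2 * ((D.A *ᵥ (mask I v).ofLp) ⬝ᵥ (D.A *ᵥ (mask I v).ofLp))
  simp only [smul_eq_mul]; ring

/-- The substitution v = M^{-1/2}u turns the eigenvalue bound into a bound on the second moment of
APE_k v. This is the only way in which the joint law of the blocks enters. -/
lemma sum_norm_opA_mask_le (hD : D.Regular) {J : Ω → Finset (Fin d)} (hJ : Measurable J) {p : ℝ}
    (hp : 0 < p) (v : Vec m) :
    ∑ I, (Pr.map J).real {I} * ((1 / p) ^ 2 * ‖D.opA (mask I v)‖ ^ 2)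
      ≤ lamMax (Mrt D p * Xi D Pr J p * Mrt D p) * (p * wnorm D.μ v) := by
  have hpos : ∀ i, 0 < p * D.μ i := fun i => mul_pos hp (hD.μ_pos _)
  have hherm : (Mrt D p * Xi D Pr J p * Mrt D p).IsHermitian := by
    have hx : (Xi D Pr J p)ᵀ = Xi D Pr J p := by
      ext a c
      rw [Matrix.transpose_apply, Xi, Matrix.of_apply, Matrix.of_apply]
      congr 1
      ext ω
      have : (actMat m (J ω) * Pmat m p * D.Aᵀ * D.A * Pmat m p * actMat m (J ω))ᵀ
          = actMat m (J ω) * Pmat m p * D.Aᵀ * D.A * Pmat m p * actMat m (J ω) := by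
        simp [Matrix.transpose_mul, actMat, Pmat, Matrix.mul_assoc]
      rw [← this, Matrix.transpose_apply, this]
    rw [Matrix.IsHermitian, Matrix.conjTranspose_eq_transpose_of_trivial]
    simp [Matrix.transpose_mul, hx, Mrt, Matrix.mul_assoc]
  set u : (Σ i, Fin (m i)) → ℝ := fun a => √(p * D.μ a.1) * v a with hu
  have h := dotProduct_mulVec_le_lamMax hherm u
  have e1 : Mrt D p *ᵥ u = v.ofLp := by
    ext a
    have hs : √(p * D.μ a.1) ≠ 0 := (Real.sqrt_pos.2 (hpos a.1)).ne'
    simp only [Mrt, Matrix.mulVec_diagonal, hu]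
    field_simp
  have e2 : u ᵥ* Mrt D p = v.ofLp := by
    rw [← e1, Mrt, ← Matrix.mulVec_transpose, Matrix.diagonal_transpose]
  have e3 : u ⬝ᵥ u = p * wnorm D.μ v := by
    rw [wnorm_eq, Finset.mul_sum, dotProduct]
    refine Finset.sum_congr rfl fun a _ => ?_
    have := Real.mul_self_sqrt (hpos a.1).le
    simp only [hu]
    linear_combination v a ^ 2 * this
  rwa [← Matrix.mulVec_mulVec, ← Matrix.mulVec_mulVec, e1, Matrix.dotProduct_mulVec, e2,
    dotProduct_Xi hJ, e3] at h

lemma wnorm_pos (hD : D.Regular) {v : Vec m} (hv : v ≠ 0) : 0 < wnorm D.μ v := by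
  have hn : 0 ≤ wnorm D.μ v := Finset.sum_nonneg fun i _ => by
    have := hD.μ_pos i
    positivity
  refine lt_of_le_of_ne hn fun h => hv (ext_blk fun i => ?_)
  have h0 := (Finset.sum_eq_zero_iff_of_nonneg fun i _ => by
    have := hD.μ_pos i
    positivity).1 h.symm i (Finset.mem_univ i)
  have := hD.μ_pos i
  have h1 : ‖blk i v‖ = 0 := by
    rcases mul_eq_zero.1 h0 with h2 | h2
    · linarith
    · exact pow_eq_zero_iff (two_ne_zero) |>.1 h2
  rw [norm_eq_zero.1 h1]
  rfl

/-- A coordinate vector picking a nonzero column of A lies in one block, so masking keeps it, with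
probability p, or kills it; its mean square is positive. This makes α a genuine positive number. -/
lemma lamMax_Xi_pos (hD : D.Regular) (hA : D.A ≠ 0) {J : Ω → Finset (Fin d)} (hJ : Measurable J)
    {p : ℝ} (hp : 0 < p) (hu : ∀ i, Pr.real {ω | i ∈ J ω} = p) :
    0 < lamMax (Mrt D p * Xi D Pr J p * Mrt D p) := by
  obtain ⟨j, a, hja⟩ : ∃ j a, D.A j a ≠ 0 := by
    by_contra! h
    exact hA (Matrix.ext h)
  set v : Vec m := WithLp.toLp 2 (Pi.single a 1) with hv
  have hv0 : v ≠ 0 := by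
    intro h
    have : v a = 0 := by rw [h]; rfl
    simp [hv] at this
  have hAv : 0 < ‖D.opA v‖ := by
    rw [norm_pos_iff]
    intro h
    have : (D.opA v) j = 0 := by rw [h]; rfl
    change (D.A *ᵥ (Pi.single a 1)) j = 0 at this
    rw [Matrix.mulVec_single_one] at this
    exact hja this
  have hlaw := isUniformLaw hJ hu
  have hsum : ∑ I, (Pr.map J).real {I} * ((1 / p) ^ 2 * ‖D.opA (mask I v)‖ ^ 2)
      = p * ((1 / p) ^ 2 * ‖D.opA v‖ ^ 2) := by
    rw [← hlaw.sum_mem a.1, Finset.sum_mul]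
    refine Finset.sum_congr rfl fun I _ => ?_
    by_cases h : a.1 ∈ I
    · have : mask I v = v := by
        ext c
        by_cases hc : c = a
        · subst hc; simp [mask, h]
        · simp [mask, hv, hc]
      rw [this, if_pos h]
    · have : mask I v = 0 := by
        ext c
        by_cases hc : c = a
        · subst hc; simp [mask, h]
        · simp [mask, hv, hc]
      rw [this, if_neg h]
      simp
  have h := sum_norm_opA_mask_le (Pr := Pr) hD hJ hp v
  rw [hsum] at h
  have h1 : 0 < p * ((1 / p) ^ 2 * ‖D.opA v‖ ^ 2) := by positivity
  exact pos_of_mul_pos_left (h1.trans_le h) (mul_pos hp (wnorm_pos hD hv0)).le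

end Spectral

/-! ### The objective as a real function on its domain. -/

namespace Data

variable {d q : ℕ} {m : Fin d → ℕ} (D : Data d q m)

/-- The domain of `R`. -/
def dom : Set (Vec m) := {x | ∀ i, D.r i (blk i x) ≠ ⊤}

/-- The contribution of block `i` to the objective, as a real number. -/
def psiBlk (i : Fin d) (u : Blk m i) : ℝ := D.φ i u + (D.r i u).toReal

/-- The real value of the objective on its domain. -/
def psi (x : Vec m) : ℝ := ∑ i, D.psiBlk i (blk i x)

namespace Regular

variable {D} (hD : D.Regular)
include hD

lemma R_eq_coe {x : Vec m} (hx : x ∈ D.dom) :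
    D.R x = ((∑ i, (D.r i (blk i x)).toReal : ℝ) : EReal) := by
  have hsum : ∀ s : Finset (Fin d), ∑ i ∈ s, D.r i (blk i x)
      = ((∑ i ∈ s, (D.r i (blk i x)).toReal : ℝ) : EReal) := by
    intro s
    induction s using Finset.induction_on with
    | empty => simp
    | insert a s ha ih =>
      rw [Finset.sum_insert ha, Finset.sum_insert ha, EReal.coe_add, ih,
        EReal.coe_toReal (hx a) (hD.ne_bot a _)]
  exact hsum _

lemma R_ne_top_iff {x : Vec m} : D.R x ≠ ⊤ ↔ x ∈ D.dom := by
  refine ⟨fun h => ?_, fun h => ?_⟩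
  · intro i hi
    apply h
    rw [R, ← Finset.add_sum_erase _ _ (Finset.mem_univ i), hi]
    apply EReal.top_add_of_ne_bot
    generalize Finset.univ.erase i = s
    induction s using Finset.induction_on with
    | empty => simp
    | insert a s ha ih =>
      rw [Finset.sum_insert ha]
      exact EReal.add_ne_bot_iff.2 ⟨hD.ne_bot _ _, ih⟩
  · rw [hD.R_eq_coe h]; exact EReal.coe_ne_top _

lemma Psi_eq_coe {x : Vec m} (hx : x ∈ D.dom) : D.Psi x = (D.psi x : EReal) := by
  rw [Psi, hD.R_eq_coe hx, ← EReal.coe_add, Phi, ← Finset.sum_add_distrib]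
  rfl

lemma Psi_ne_top_iff {x : Vec m} : D.Psi x ≠ ⊤ ↔ x ∈ D.dom := by
  refine ⟨fun h => ?_, fun h => ?_⟩
  · rw [← hD.R_ne_top_iff]
    intro h'
    apply h
    rw [Psi, h', EReal.coe_add_top]
  · rw [hD.Psi_eq_coe h]; exact EReal.coe_ne_top _

lemma toReal_Psi {x : Vec m} (hx : x ∈ D.dom) : (D.Psi x).toReal = D.psi x := by
  rw [hD.Psi_eq_coe hx, EReal.toReal_coe]

lemma strongConvexOn_psiBlk (i : Fin d) :
    StrongConvexOn {x | D.r i x ≠ ⊤} (D.μ i) (D.psiBlk i) := by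
  refine ⟨(hD.strongConvex i).1, fun u hu v hv a b ha hb hab => ?_⟩
  have h := (hD.strongConvex i).2 hu hv ha hb hab
  simp only [smul_eq_mul] at h
  set z := a • u + b • v with hz
  have h1 := hD.convex i z (u - z)
  have h2 := hD.convex i z (v - z)
  rw [add_sub_cancel] at h1 h2
  have h3 : a * inner ℝ (∇ (D.φ i) z) (u - z) + b * inner ℝ (∇ (D.φ i) z) (v - z) = (0 : ℝ) := by
    rw [← real_inner_smul_right, ← real_inner_smul_right, ← inner_add_right]
    have : a • (u - z) + b • (v - z) = 0 := by
      have : a • (u - z) + b • (v - z) = z - (a + b) • z := by rw [hz]; module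
      rw [this, hab, one_smul, sub_self]
    rw [this, inner_zero_right]
  have h4 := mul_nonneg ha h1
  have h5 := mul_nonneg hb h2
  obtain rfl : b = 1 - a := by linarith
  simp only [psiBlk, smul_eq_mul]
  nlinarith

lemma convexOn_psi : ConvexOn ℝ D.dom D.psi := by
  have hc : ∀ i, ConvexOn ℝ {x | D.r i x ≠ ⊤} (D.psiBlk i) := fun i =>
    strongConvexOn_zero.1 ((hD.strongConvexOn_psiBlk i).mono (hD.μ_pos i).le)
  refine ⟨fun u hu v hv a b ha hb hab i => ?_, fun u hu v hv a b ha hb hab => ?_⟩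
  · exact (hc i).1 (hu i) (hv i) ha hb hab
  · rw [psi, psi, psi, Finset.smul_sum, Finset.smul_sum, ← Finset.sum_add_distrib]
    exact Finset.sum_le_sum fun i _ => (hc i).2 (hu i) (hv i) ha hb hab

/-- A subgradient inequality for `Ψ` improves by the strong convexity of `R`. -/
lemma psi_add_wnorm_le {g x : Vec m} (h : D.IsSubgradient g x) {u : Vec m} (hu : u ∈ D.dom) :
    D.psi x + inner ℝ g (u - x) + 1 / 2 * wnorm D.μ (u - x) ≤ D.psi u := by
  have hx := hD.Psi_ne_top_iff.1 h.1
  have hsub : ∀ u ∈ D.dom, D.psi x + inner ℝ g (u - x) ≤ D.psi u := by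
    intro u hu
    have := h.2 u
    rw [hD.Psi_eq_coe hx, hD.Psi_eq_coe hu] at this
    exact_mod_cast this
  have hblk : ∀ i, D.psiBlk i (blk i x) + inner ℝ (blk i g) (blk i (u - x))
      + 1 / 2 * (D.μ i * ‖blk i (u - x)‖ ^ 2) ≤ D.psiBlk i (blk i u) := by
    intro i
    -- Perturbing only block i reduces the global subgradient inequality to one block, where strong
    -- convexity with its own modulus μ_i applies; summing restores the weighted norm.
    have hmin : ∀ v, D.r i v ≠ ⊤ →
        D.psiBlk i (blk i x) + inner ℝ (blk i g) (v - blk i x) ≤ D.psiBlk i v := by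
      intro v hv
      classical
      set w : Vec m := ofBlks (Function.update (fun j => blk j x) i v) with hw
      have hwj : ∀ j, j ≠ i → blk j w = blk j x := by
        intro j hj
        rw [hw, blk_ofBlks, Function.update_of_ne hj]
      have hwi : blk i w = v := by rw [hw, blk_ofBlks, Function.update_self]
      have hwd : w ∈ D.dom := by
        intro j
        by_cases hj : j = i
        · subst hj; rwa [hwi]
        · rw [hwj j hj]; exact hx j
      have h1 := hsub w hwd
      rw [inner_eq_sum_blk, psi, psi, ← Finset.add_sum_erase _ _ (Finset.mem_univ i),
        ← Finset.add_sum_erase _ (fun j => (inner ℝ (blk j g) (blk j (w - x)) : ℝ))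
          (Finset.mem_univ i),
        ← Finset.add_sum_erase _ (fun j => D.psiBlk j (blk j w)) (Finset.mem_univ i)] at h1
      have e1 : ∑ j ∈ Finset.univ.erase i, D.psiBlk j (blk j w)
          = ∑ j ∈ Finset.univ.erase i, D.psiBlk j (blk j x) :=
        Finset.sum_congr rfl fun j hj => by rw [hwj j (Finset.ne_of_mem_erase hj)]
      have e2 : ∑ j ∈ Finset.univ.erase i, (inner ℝ (blk j g) (blk j (w - x)) : ℝ) = 0 :=
        Finset.sum_eq_zero fun j hj => by
          rw [blk_sub, hwj j (Finset.ne_of_mem_erase hj), sub_self, inner_zero_right]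
      rw [e1, e2, blk_sub, hwi] at h1
      linarith
    have h2 := strongConvexOn_add_sq_norm_le
      (strongConvexOn_add_inner_add_sq (hD.strongConvexOn_psiBlk i) (-blk i g) (blk i x) 0)
      (by linarith [hD.μ_pos i]) (v := blk i x) (hx i) (fun v hv => ?_) (u := blk i u) (hu i)
    · simp only [sub_self, inner_zero_right, norm_zero, inner_neg_left, add_zero, zero_mul] at h2
      rw [blk_sub]
      linarith
    · have := hmin v hv
      simp only [sub_self, inner_zero_right, norm_zero, inner_neg_left, zero_mul]
      linarith
  have := Finset.sum_le_sum fun i (_ : i ∈ Finset.univ) => hblk i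
  rw [Finset.sum_add_distrib, Finset.sum_add_distrib, ← Finset.mul_sum, ← inner_eq_sum_blk] at this
  exact this

end Regular

end Data

/-! ### The one-step Lyapunov inequality. -/

section OneStep

variable {d q : ℕ} {m : Fin d → ℕ} {D : Data d q m}

/-- All randomness of the step sits in the mask: the update of every block at once does not depend
on the sampled set. -/
lemma xNext_eq_add_mask (p t S θ : ℝ) (I : Finset (Fin d)) (s : Vec m × Vec m) :
    xNext D p t S θ I s = s.1 + mask I (xNext D p t S θ Finset.univ s - s.1) := by
  refine ext_blk fun i => ?_
  rw [blk_add, blk_mask, blk_sub]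
  by_cases h : i ∈ I <;> simp [xNext, h]

lemma xNext_mem_dom (hD : D.Regular) {p t S θ : ℝ} (hp : 0 < p) (ht : 0 < t) (I : Finset (Fin d))
    {s : Vec m × Vec m} (hs : s.1 ∈ D.dom) : xNext D p t S θ I s ∈ D.dom := by
  intro i
  have hμ := hD.μ_pos i
  rw [xNext, blk_ofBlks]
  split_ifs
  · exact hD.r_FB_ne_top i _ _ (by positivity)
  · exact hs i

lemma blk_step (p t S θ : ℝ) (I : Finset (Fin d)) (s : Vec m × Vec m) (i : Fin d) :
    blk i (xNext D p t S θ I s)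
      = if i ∈ I then blk i (xNext D p t S θ Finset.univ s) else blk i s.1 := by
  by_cases h : i ∈ I <;> simp [xNext, h]

lemma IsUniformLaw.sum_mul_sum_ite {Q : Finset (Fin d) → ℝ} {p : ℝ} (hQ : IsUniformLaw Q p)
    (a b : Fin d → ℝ) :
    ∑ I, Q I * ∑ i, (if i ∈ I then a i else b i) = p * ∑ i, a i + (1 - p) * ∑ i, b i := by
  have hn : ∀ i, (∑ I, if i ∈ I then 0 else Q I) = 1 - p := by
    intro i
    rw [← hQ.sum_eq_one, ← hQ.sum_mem i, ← Finset.sum_sub_distrib]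
    refine Finset.sum_congr rfl fun I _ => ?_
    split_ifs <;> simp
  simp_rw [Finset.mul_sum]
  rw [Finset.sum_comm, ← Finset.sum_add_distrib]
  refine Finset.sum_congr rfl fun i _ => ?_
  conv_rhs => rw [← hn i, ← hQ.sum_mem i, Finset.sum_mul, Finset.sum_mul, ← Finset.sum_add_distrib]
  refine Finset.sum_congr rfl fun I _ => ?_
  split_ifs <;> simp

/-- Blockwise sum of the three-point inequality, with the smooth part handled by the descent
inequality at the new point and by convexity at u. -/
lemma full_step_le (hD : D.Regular) {p t S θ : ℝ} (hp : 0 < p) (ht : 0 < t) {s : Vec m × Vec m}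
    {u : Vec m} (hu : u ∈ D.dom) :
    D.psi (xNext D p t S θ Finset.univ s)
        + S * inner ℝ (∇ D.h (zPoint θ s)) (xNext D p t S θ Finset.univ s - u)
        + p / t / 2 * wnorm D.μ (xNext D p t S θ Finset.univ s - s.1)
        + (1 + p / t) / 2 * wnorm D.μ (xNext D p t S θ Finset.univ s - u)
      ≤ D.psi u + p / t / 2 * wnorm D.μ (s.1 - u)
        + 1 / 2 * wnorm D.L (xNext D p t S θ Finset.univ s - s.1) := by
  rw [inner_eq_sum_blk, Data.psi, Data.psi]
  simp only [wnorm, Finset.mul_sum, ← Finset.sum_add_distrib]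
  refine Finset.sum_le_sum fun i _ => ?_
  have hμ := hD.μ_pos i
  have hc : 0 < 1 / (p * t) * (p ^ 2 * D.μ i) := by positivity
  have h1 := hD.FB_three_point i
    (∇ (D.φ i) (blk i s.1) + S • blk i (∇ D.h (zPoint θ s))) (blk i s.1) hc (hu i)
  have hb : blk i (xNext D p t S θ Finset.univ s) = FB D i
      (∇ (D.φ i) (blk i s.1) + S • blk i (∇ D.h (zPoint θ s))) (blk i s.1)
        (1 / (p * t) * (p ^ 2 * D.μ i)) := by simp [xNext]
  rw [← hb] at h1
  simp only [blk_sub]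
  generalize blk i (xNext D p t S θ Finset.univ s) = v at h1 ⊢
  generalize hxe : blk i s.1 = x at h1 ⊢
  have h2 := hD.descent i x (v - x)
  have h3 := hD.convex i x (blk i u - x)
  rw [add_sub_cancel] at h2 h3
  rw [inner_add_left, real_inner_smul_left] at h1
  have e : (inner ℝ (∇ (D.φ i) x) (v - blk i u) : ℝ)
      = inner ℝ (∇ (D.φ i) x) (v - x) - inner ℝ (∇ (D.φ i) x) (blk i u - x) := by
    rw [← inner_sub_right]; congr 1; abel
  rw [e] at h1
  have hce : 1 / (p * t) * (p ^ 2 * D.μ i) = p / t * D.μ i := by field_simp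
  rw [hce] at h1
  simp only [Data.psiBlk]
  linarith

lemma wnorm_L_le (hD : D.Regular) {κ p : ℝ}
    (hκ : ∀ i, 0 < m i → D.L i + D.μ i ≤ κ * (p * D.μ i)) (v : Vec m) :
    wnorm D.L v ≤ κ * p * wnorm D.μ v := by
  rw [wnorm, wnorm, Finset.mul_sum]
  refine Finset.sum_le_sum fun i _ => ?_
  rcases Nat.eq_zero_or_pos (m i) with h | h
  · have : IsEmpty (Fin (m i)) := by rw [h]; infer_instance
    have : blk i v = 0 := Subsingleton.elim _ _
    simp [this]
  · have := hκ i h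
    have := hD.μ_pos i
    nlinarith [sq_nonneg ‖blk i v‖]

lemma opA_zPoint_sub (p θ : ℝ) (s : Vec m × Vec m) (xs v : Vec m) :
    D.opA (zPoint θ s + θ • WithLp.toLp 2 (Pmat m p *ᵥ v.ofLp) - xs)
      = D.opA (zPoint θ s - xs) + (θ / p) • D.opA v := by
  have e : (WithLp.toLp 2 (Pmat m p *ᵥ v.ofLp) : Vec m) = (1 / p) • v := by
    ext c
    simp [Pmat, Matrix.mulVec_diagonal]
  rw [e, ← map_smul, ← map_add]
  congr 1
  module

/-- Expanding the square, the cross term needs only that the mean of the masked vector is pδ; the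
last term is the second-moment bound `hQA`. -/
lemma IsUniformLaw.sum_norm_sq_le {Q : Finset (Fin d) → ℝ} {p α θ : ℝ} (hQ : IsUniformLaw Q p)
    (hp : 0 < p)
    (hQA : ∀ v : Vec m, ∑ I, Q I * ((1 / p) ^ 2 * ‖D.opA (mask I v)‖ ^ 2) ≤ α⁻¹ * (p * wnorm D.μ v))
    (a : EuclideanSpace ℝ (Fin q)) (δ : Vec m) :
    ∑ I, Q I * (1 / 2 * ‖a + (θ / p) • D.opA (mask I δ)‖ ^ 2)
      ≤ 1 / 2 * ‖a‖ ^ 2 + θ * inner ℝ a (D.opA δ) + θ ^ 2 / 2 * (α⁻¹ * (p * wnorm D.μ δ)) := by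
  have hlin : ∑ I, Q I * inner ℝ a (D.opA (mask I δ)) = p * inner ℝ a (D.opA δ) := by
    have e : ∑ I, Q I • mask I δ = p • δ := by
      ext c
      rw [WithLp.ofLp_sum, Finset.sum_apply, PiLp.smul_apply, smul_eq_mul, ← hQ.sum_mem c.1,
        Finset.sum_mul]
      refine Finset.sum_congr rfl fun I _ => ?_
      by_cases h : c.1 ∈ I <;> simp [mask, h]
    rw [← real_inner_smul_right, ← map_smul, ← e, map_sum, inner_sum]
    refine Finset.sum_congr rfl fun I _ => ?_
    rw [map_smul, real_inner_smul_right]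
  have e : ∀ I, Q I * (1 / 2 * ‖a + (θ / p) • D.opA (mask I δ)‖ ^ 2)
      = Q I * (1 / 2 * ‖a‖ ^ 2) + θ / p * (Q I * inner ℝ a (D.opA (mask I δ)))
        + θ ^ 2 / 2 * (Q I * ((1 / p) ^ 2 * ‖D.opA (mask I δ)‖ ^ 2)) := by
    intro I
    rw [norm_add_sq_real, real_inner_smul_right, norm_smul, mul_pow, Real.norm_eq_abs, sq_abs]
    ring
  simp_rw [e]
  rw [Finset.sum_add_distrib, Finset.sum_add_distrib, ← Finset.sum_mul, ← Finset.mul_sum,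
    ← Finset.mul_sum, hlin, hQ.sum_eq_one, one_mul]
  have := mul_le_mul_of_nonneg_left (hQA δ) (by positivity : 0 ≤ θ ^ 2 / 2)
  have e2 : θ / p * (p * inner ℝ a (D.opA δ)) = θ * inner ℝ a (D.opA δ) := by field_simp
  linarith

lemma norm_sq_sub_inner_eq {F : Type*} [NormedAddCommGroup F] [InnerProductSpace ℝ F] {S σ : ℝ}
    {a u v : F} (hSa : S • a = (S - σ) • u + σ • v) :
    S ^ 2 * (1 / 2 * ‖a‖ ^ 2) - S * σ * inner ℝ a v
      = (S - σ) ^ 2 * (1 / 2 * ‖u‖ ^ 2) - σ ^ 2 * (1 / 2 * ‖v‖ ^ 2) := by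
  have e1 : S ^ 2 * ‖a‖ ^ 2 = ‖S • a‖ ^ 2 := by
    rw [norm_smul, mul_pow, Real.norm_eq_abs, sq_abs]
  have e2 : S * inner ℝ a v = inner ℝ (S • a) v := by rw [real_inner_smul_left]
  have e3 : S ^ 2 * (1 / 2 * ‖a‖ ^ 2) - S * σ * inner ℝ a v
      = 1 / 2 * (S ^ 2 * ‖a‖ ^ 2) - σ * (S * inner ℝ a v) := by ring
  rw [e3, e1, e2, hSa, norm_add_sq_real, norm_smul, norm_smul, mul_pow, mul_pow, Real.norm_eq_abs,
    Real.norm_eq_abs, sq_abs, sq_abs, inner_add_left, real_inner_smul_left, real_inner_smul_left,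
    real_inner_smul_right, real_inner_smul_left, real_inner_self_eq_norm_sq]
  ring

/-- The Lyapunov function at the point `s = (x, w)` with the upper estimate `f` of `Ψ(w)`. -/
def lyap (D : Data d q m) (xs : Vec m) (S ρ : ℝ) (s : Vec m × Vec m) (f : ℝ) : ℝ :=
  S * (f - D.psi xs) + S ^ 2 * (1 / 2 * ‖D.opA (s.2 - xs)‖ ^ 2) + ρ / 2 * wnorm D.μ (s.1 - xs)

lemma sum_lyap_le (hD : D.Regular) {Q : Finset (Fin d) → ℝ} {α κ p t S σ : ℝ}
    (hp : 0 < p) (ht : 0 < t) (hS : 0 < S) (hσ : 0 < σ) (hα : 0 < α) (hσe : σ = α * (1 / t - κ))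
    (hQ : IsUniformLaw Q p)
    (hQA : ∀ v : Vec m, ∑ I, Q I * ((1 / p) ^ 2 * ‖D.opA (mask I v)‖ ^ 2) ≤ α⁻¹ * (p * wnorm D.μ v))
    (hκ : ∀ i, 0 < m i → D.L i + D.μ i ≤ κ * (p * D.μ i))
    {xs : Vec m} (hxs : xs ∈ D.dom)
    (hne : (D.Aᵀ * D.A) *ᵥ xs.ofLp - D.Aᵀ *ᵥ D.b.ofLp = 0) (s : Vec m × Vec m) (f : ℝ) :
    ∑ I, Q I * lyap D xs S (σ * (1 / t + 1 / p))
        (xNext D p t S (σ / S) I s, zPoint (σ / S) s + (σ / S) •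
          WithLp.toLp 2 (Pmat m p *ᵥ (xNext D p t S (σ / S) I s - s.1).ofLp))
        ((1 - σ / S) * f + σ / S * D.psi s.1
          + σ / S / p * (D.psi (xNext D p t S (σ / S) I s) - D.psi s.1))
      ≤ lyap D xs (S - σ) (σ * (1 / t + 1 / p - 1)) s f
        - σ ^ 2 * (1 / 2 * ‖D.opA (s.1 - xs)‖ ^ 2) := by
  set θ := σ / S with hθ
  have hθS : θ * S = σ := by rw [hθ]; field_simp
  set xh := xNext D p t S θ Finset.univ s with hxh
  set δ := xh - s.1 with hδ
  have hstep := full_step_le (θ := θ) (S := S) hD hp ht (s := s) hxs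
  rw [← hxh] at hstep
  have hψ : ∑ I, Q I * D.psi (xNext D p t S θ I s) = p * D.psi xh + (1 - p) * D.psi s.1 := by
    rw [Data.psi, Data.psi, ← hQ.sum_mul_sum_ite]
    refine Finset.sum_congr rfl fun I _ => ?_
    rw [Data.psi]
    congr 1
    refine Finset.sum_congr rfl fun i _ => ?_
    rw [blk_step]; split_ifs <;> rfl
  have hW : ∑ I, Q I * wnorm D.μ (xNext D p t S θ I s - xs)
      = p * wnorm D.μ (xh - xs) + (1 - p) * wnorm D.μ (s.1 - xs) := by
    rw [wnorm, wnorm, ← hQ.sum_mul_sum_ite]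
    refine Finset.sum_congr rfl fun I _ => ?_
    rw [wnorm]
    congr 1
    refine Finset.sum_congr rfl fun i _ => ?_
    rw [blk_sub, blk_step]; split_ifs <;> rfl
  set a := D.opA (zPoint θ s - xs) with ha
  set u := D.opA (s.2 - xs) with hu
  set v := D.opA (s.1 - xs) with hv
  have hSa : S • a = (S - σ) • u + σ • v := by
    rw [ha, hu, hv, ← map_smul, ← map_smul, ← map_smul, ← map_add]
    congr 1
    rw [zPoint, ← hθS]
    module
  have hw : ∀ I, D.opA (zPoint θ s + θ •
        WithLp.toLp 2 (Pmat m p *ᵥ (xNext D p t S θ I s - s.1).ofLp) - xs)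
      = a + (θ / p) • D.opA (mask I δ) := by
    intro I
    rw [opA_zPoint_sub, xNext_eq_add_mask, add_sub_cancel_left]
  have hδe : D.opA δ = D.opA (xh - xs) - v := by
    rw [hv, ← map_sub]; congr 1; rw [hδ]; abel
  have hgrad : (inner ℝ (∇ D.h (zPoint θ s)) (xh - xs) : ℝ) = inner ℝ a (D.opA (xh - xs)) := by
    have e := D.inner_opA_sub_b_eq_zero hne (xh - xs)
    rw [D.inner_gradient_h, ha]
    have : D.opA (zPoint θ s) - D.b = D.opA (zPoint θ s - xs) + (D.opA xs - D.b) := by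
      rw [map_sub]; abel
    rw [this, inner_add_left, e, add_zero]
  have hquad := hQ.sum_norm_sq_le (θ := θ) hp hQA a δ
  have hsum : ∑ I, Q I * lyap D xs S (σ * (1 / t + 1 / p))
        (xNext D p t S θ I s, zPoint θ s + θ •
          WithLp.toLp 2 (Pmat m p *ᵥ (xNext D p t S θ I s - s.1).ofLp))
        ((1 - θ) * f + θ * D.psi s.1 + θ / p * (D.psi (xNext D p t S θ I s) - D.psi s.1))
      = S * ((1 - θ) * f + θ * D.psi xh - D.psi xs)
        + S ^ 2 * ∑ I, Q I * (1 / 2 * ‖a + (θ / p) • D.opA (mask I δ)‖ ^ 2)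
        + σ * (1 / t + 1 / p) / 2 * (p * wnorm D.μ (xh - xs) + (1 - p) * wnorm D.μ (s.1 - xs)) := by
    have e : ∀ I, Q I * lyap D xs S (σ * (1 / t + 1 / p))
        (xNext D p t S θ I s, zPoint θ s + θ •
          WithLp.toLp 2 (Pmat m p *ᵥ (xNext D p t S θ I s - s.1).ofLp))
        ((1 - θ) * f + θ * D.psi s.1 + θ / p * (D.psi (xNext D p t S θ I s) - D.psi s.1))
        = Q I * (S * ((1 - θ) * f + θ * D.psi s.1 - θ / p * D.psi s.1 - D.psi xs))
          + S * θ / p * (Q I * D.psi (xNext D p t S θ I s))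
          + S ^ 2 * (Q I * (1 / 2 * ‖a + (θ / p) • D.opA (mask I δ)‖ ^ 2))
          + σ * (1 / t + 1 / p) / 2 * (Q I * wnorm D.μ (xNext D p t S θ I s - xs)) := by
      intro I
      rw [lyap, hw]
      ring
    simp_rw [e]
    rw [Finset.sum_add_distrib, Finset.sum_add_distrib, Finset.sum_add_distrib, ← Finset.sum_mul,
      ← Finset.mul_sum, ← Finset.mul_sum, ← Finset.mul_sum, hψ, hW, hQ.sum_eq_one]
    field_simp
    ring
  have hid := norm_sq_sub_inner_eq hSa
  have hLμ := wnorm_L_le hD hκ δ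
  rw [hsum, lyap, ← hu]
  rw [hδe, inner_sub_right] at hquad
  rw [hgrad] at hstep
  have h1 := mul_le_mul_of_nonneg_left hquad (by positivity : 0 ≤ S ^ 2)
  have h2 := mul_le_mul_of_nonneg_left hstep hσ.le
  have h3 := mul_le_mul_of_nonneg_left hLμ (by positivity : 0 ≤ σ / 2)
  -- This is where the coupling of σ and t acts: the second-moment term σ²p/(2α) becomes σ/2 (p/t -
  -- κp), and with the smoothness error κp it exactly cancels the proximal term p/t of the full
  -- step.
  have e1 : S ^ 2 * (θ ^ 2 / 2 * (α⁻¹ * (p * wnorm D.μ δ)))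
      = σ / 2 * (p / t - κ * p) * wnorm D.μ δ := by
    have : S ^ 2 * (θ ^ 2 / 2 * (α⁻¹ * (p * wnorm D.μ δ)))
        = (θ * S) ^ 2 / 2 * (α⁻¹ * (p * wnorm D.μ δ)) := by ring
    rw [this, hθS]
    have : α⁻¹ * σ = 1 / t - κ := by rw [hσe]; field_simp
    linear_combination σ / 2 * (p * wnorm D.μ δ) * this
  have e2 : S ^ 2 * (θ * (inner ℝ a (D.opA (xh - xs)) - inner ℝ a v))
      = S * σ * (inner ℝ a (D.opA (xh - xs)) - inner ℝ a v) := by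
    rw [← hθS]; ring
  have e3 : S * ((1 - θ) * f + θ * D.psi xh - D.psi xs)
      = (S - σ) * (f - D.psi xs) + σ * (D.psi xh - D.psi xs) := by
    rw [← hθS]; ring
  have e4 : σ * (1 / t + 1 / p) / 2 * (p * wnorm D.μ (xh - xs) + (1 - p) * wnorm D.μ (s.1 - xs))
      = σ * ((1 + p / t) / 2 * wnorm D.μ (xh - xs))
        + σ * (1 / t + 1 / p - 1) / 2 * wnorm D.μ (s.1 - xs)
        - σ * (p / t / 2 * wnorm D.μ (s.1 - xs)) := by
    field_simp
    ring
  rw [e3, e4]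
  rw [mul_add, mul_add, e1, e2] at h1
  linarith [h1, h2, h3, hid]

end OneStep

/-! ### Supermartingales driven by an i.i.d. sequence in a finite set. -/

section Supermartingale

variable {X Ω : Type*} {ξ : ℕ → Ω → X}

/-- The first `k` values of the process `ξ`. -/
def hist (ξ : ℕ → Ω → X) (k : ℕ) (ω : Ω) : Finset.range k → X := fun j => ξ j ω

lemma measurable_hist [MeasurableSpace X] [MeasurableSpace Ω] (hξ : ∀ k, Measurable (ξ k)) (k : ℕ) : Measurable (hist ξ k) :=
  measurable_pi_lambda _ fun j => hξ j

/-- The filtration of the strict past of `ξ`. -/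
def histFiltration [MeasurableSpace X] [mΩ : MeasurableSpace Ω] (hξ : ∀ k, Measurable (ξ k)) : Filtration ℕ mΩ where
  seq k := MeasurableSpace.comap (hist ξ k) inferInstance
  mono' k l hkl := by
    have e : hist ξ k = (fun h (j : Finset.range k) =>
        h ⟨j, Finset.mem_range.2 ((Finset.mem_range.1 j.2).trans_le hkl)⟩) ∘ hist ξ l := rfl
    change MeasurableSpace.comap (hist ξ k) _ ≤ MeasurableSpace.comap (hist ξ l) _
    rw [e, ← MeasurableSpace.comap_comp]
    exact MeasurableSpace.comap_mono
      (measurable_iff_comap_le.1 (measurable_pi_lambda _ fun j => measurable_pi_apply _))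
  le' k := measurable_iff_comap_le.1 (measurable_hist hξ k)

open Classical in
/-- Extend a finite history by arbitrary values. -/
def extendHist [Nonempty X] (k : ℕ) (h : Finset.range k → X) : ℕ → X := fun j =>
  if hj : j ∈ Finset.range k then h ⟨j, hj⟩ else Classical.arbitrary X

lemma extendHist_hist [Nonempty X] (k : ℕ) (ω : Ω) {j : ℕ} (hj : j < k) :
    extendHist k (hist ξ k ω) j = ξ j ω := by
  rw [extendHist, dif_pos (Finset.mem_range.2 hj)]
  rfl

/-- A real function of a sequence is determined by the first `k` terms. -/
def DependsOnFirst (k : ℕ) (f : (ℕ → X) → ℝ) : Prop := ∀ I J, (∀ j < k, I j = J j) → f I = f J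

lemma DependsOnFirst.eq_comp_hist [Nonempty X] {k : ℕ} {f : (ℕ → X) → ℝ} (hf : DependsOnFirst k f) :
    (fun ω => f fun j => ξ j ω) = (fun h => f (extendHist k h)) ∘ hist ξ k := by
  ext ω
  exact hf _ _ fun j hj => (extendHist_hist k ω hj).symm

variable [Fintype X] [Nonempty X] [MeasurableSpace X] [MeasurableSingletonClass X]
  [mΩ : MeasurableSpace Ω] {Pr : Measure Ω} [IsProbabilityMeasure Pr]

/-- There are finitely many histories of length k, so the function takes finitely many values. -/
lemma DependsOnFirst.integrable {k : ℕ} {f : (ℕ → X) → ℝ} (hf : DependsOnFirst k f)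
    (hξ : ∀ k, Measurable (ξ k)) : Integrable (fun ω => f fun j => ξ j ω) Pr := by
  rw [hf.eq_comp_hist]
  have : IsProbabilityMeasure (Pr.map (hist ξ k)) :=
    Measure.isProbabilityMeasure_map (measurable_hist hξ k).aemeasurable
  exact (Integrable.of_finite (μ := Pr.map (hist ξ k))).comp_measurable (measurable_hist hξ k)

/-- By independence the law of (history, ξ_k) is a product; Fubini reduces the claim to the
pointwise bound on the average over the next value. -/
lemma setIntegral_succ_le (hξ : ∀ k, Measurable (ξ k)) (hind : iIndepFun ξ Pr) {Q : X → ℝ}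
    {k : ℕ} (hQ : ∀ F, (Pr.map (ξ k)).real {F} = Q F) {f g : (ℕ → X) → ℝ}
    (hf : DependsOnFirst k f) (hg : DependsOnFirst (k + 1) g)
    (hle : ∀ I, ∑ F, Q F * g (Function.update I k F) ≤ f I) {s : Set Ω}
    (hs : MeasurableSet[histFiltration hξ k] s) :
    ∫ ω in s, g (fun j => ξ j ω) ∂Pr ≤ ∫ ω in s, f (fun j => ξ j ω) ∂Pr := by
  obtain ⟨B, hB, rfl⟩ := hs
  have hH := measurable_hist hξ k
  have hHp : IsProbabilityMeasure (Pr.map (hist ξ k)) :=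
    Measure.isProbabilityMeasure_map hH.aemeasurable
  have hKp : IsProbabilityMeasure (Pr.map (ξ k)) :=
    Measure.isProbabilityMeasure_map (hξ k).aemeasurable
  have hi : hist ξ k ⟂ᵢ[Pr] ξ k := by
    have h := hind.indepFun_finset (Finset.range k) {k} (by simp) hξ
    exact h.comp (ψ := fun (u : ({k} : Finset ℕ) → X) => u ⟨k, Finset.mem_singleton_self k⟩)
      measurable_id (measurable_pi_apply _)
  have hprod := (indepFun_iff_map_prod_eq_prod_map_map hH.aemeasurable (hξ k).aemeasurable).1 hi
  set G : (Finset.range k → X) → X → ℝ := fun h F => g (Function.update (extendHist k h) k F)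
    with hG
  have hgG : ∀ ω, g (fun j => ξ j ω) = G (hist ξ k ω) (ξ k ω) := by
    intro ω
    refine hg _ _ fun j hj => ?_
    rcases Nat.lt_succ_iff_lt_or_eq.1 hj with h | rfl
    · rw [Function.update_of_ne h.ne, extendHist_hist k ω h]
    · rw [Function.update_self]
  have h1 : ∫ ω in hist ξ k ⁻¹' B, g (fun j => ξ j ω) ∂Pr
      = ∫ h, ∑ F, Q F * B.indicator (fun h => G h F) h ∂(Pr.map (hist ξ k)) := by
    rw [← integral_indicator (hH hB)]
    have e : (hist ξ k ⁻¹' B).indicator (fun ω => g (fun j => ξ j ω))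
        = fun ω => (fun z : (Finset.range k → X) × X => B.indicator (fun h => G h z.2) z.1)
          (hist ξ k ω, ξ k ω) := by
      ext ω
      by_cases h : hist ξ k ω ∈ B
      · rw [Set.indicator_of_mem (show ω ∈ hist ξ k ⁻¹' B from h), hgG]
        simp only [Set.indicator_of_mem h]
      · rw [Set.indicator_of_notMem (show ω ∉ hist ξ k ⁻¹' B from h)]
        simp only [Set.indicator_of_notMem h]
    rw [e, ← integral_map (hH.prodMk (hξ k)).aemeasurable
      (measurable_of_finite _).aestronglyMeasurable, hprod,
      integral_prod _ Integrable.of_finite]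
    congr 1
    ext h
    rw [integral_fintype Integrable.of_finite]
    exact Finset.sum_congr rfl fun F _ => by rw [hQ]; rfl
  have h2 : ∫ ω in hist ξ k ⁻¹' B, f (fun j => ξ j ω) ∂Pr
      = ∫ h, B.indicator (fun h => f (extendHist k h)) h ∂(Pr.map (hist ξ k)) := by
    rw [← integral_indicator (hH hB), integral_map hH.aemeasurable
      (measurable_of_finite _).aestronglyMeasurable, hf.eq_comp_hist]
    rfl
  rw [h1, h2]
  refine integral_mono Integrable.of_finite Integrable.of_finite fun h => ?_
  by_cases hh : h ∈ B
  · simp only [Set.indicator_of_mem hh]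
    exact hle _
  · simp [Set.indicator_of_notMem hh]

variable {Q : X → ℝ} {U : ℕ → (ℕ → X) → ℝ}

lemma integral_le_integral_zero (hξ : ∀ k, Measurable (ξ k)) (hind : iIndepFun ξ Pr)
    (hQ : ∀ k F, (Pr.map (ξ k)).real {F} = Q F) (hdep : ∀ k, DependsOnFirst k (U k))
    (hle : ∀ k I, ∑ F, Q F * U (k + 1) (Function.update I k F) ≤ U k I) (k : ℕ) :
    ∫ ω, U k (fun j => ξ j ω) ∂Pr ≤ ∫ ω, U 0 (fun j => ξ j ω) ∂Pr := by
  induction k with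
  | zero => exact le_rfl
  | succ k ih =>
    have := setIntegral_succ_le hξ hind (hQ k) (hdep k) (hdep (k + 1)) (hle k)
      (s := Set.univ) MeasurableSet.univ
    rw [setIntegral_univ, setIntegral_univ] at this
    exact this.trans ih

/-- A nonnegative functional of the past of an i.i.d. sequence that decreases in conditional mean
is almost surely bounded. -/
lemma ae_exists_forall_le (hξ : ∀ k, Measurable (ξ k)) (hind : iIndepFun ξ Pr)
    (hQ : ∀ k F, (Pr.map (ξ k)).real {F} = Q F) (hdep : ∀ k, DependsOnFirst k (U k))
    (hnn : ∀ k I, 0 ≤ U k I)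
    (hle : ∀ k I, ∑ F, Q F * U (k + 1) (Function.update I k F) ≤ U k I) :
    ∀ᵐ ω ∂Pr, ∃ C, ∀ k, U k (fun j => ξ j ω) ≤ C := by
  have hint := fun k => (hdep k).integrable (Pr := Pr) hξ
  have hsuper : Supermartingale (fun k ω => U k fun j => ξ j ω) (histFiltration hξ) Pr := by
    refine supermartingale_of_setIntegral_succ_le (fun k => ?_) hint fun k s hs =>
      setIntegral_succ_le hξ hind (hQ k) (hdep k) (hdep (k + 1)) (hle k) hs
    rw [(hdep k).eq_comp_hist]
    exact ((measurable_of_finite fun h => U k (extendHist k h)).comp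
      (comap_measurable (hist ξ k))).stronglyMeasurable
  -- By nonnegativity the L¹ norm is the mean, which is at most the initial one. So -U is an
  -- L¹-bounded submartingale; it converges almost surely, and a convergent sequence is bounded.
  have hbdd : ∀ k, eLpNorm ((-fun k ω => U k fun j => ξ j ω) k) 1 Pr
      ≤ (∫ ω, U 0 (fun j => ξ j ω) ∂Pr).toNNReal := by
    intro k
    rw [Pi.neg_apply, eLpNorm_neg, eLpNorm_one_eq_lintegral_enorm,
      ← ofReal_integral_norm_eq_lintegral_enorm (hint k)]
    apply ENNReal.ofReal_le_ofReal
    simp_rw [Real.norm_of_nonneg (hnn _ _)]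
    exact integral_le_integral_zero hξ hind hQ hdep hle k
  filter_upwards [hsuper.neg.exists_ae_tendsto_of_bdd hbdd] with ω ⟨c, hc⟩
  obtain ⟨C, hC⟩ := hc.bddBelow_range
  refine ⟨-C, fun k => ?_⟩
  have := hC (Set.mem_range_self k)
  simp only [Pi.neg_apply] at this
  linarith

end Supermartingale

/-! ### Jensen's inequality for the averaged iterates. -/

section Trajectory

variable {d q : ℕ} {m : Fin d → ℕ} (D : Data d q m)

/-- The combination of the values `Ψ(x^0), …, Ψ(x^k)` with the weights that express `w^k` through
`x^0, …, x^k`; it is an upper bound of `Ψ(w^k)`. -/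
def psiHat (p : ℝ) (τ σ : ℕ → ℝ) (x₀ : Vec m) (I : ℕ → Finset (Fin d)) : ℕ → ℝ
  | 0 => D.psi x₀
  | k + 1 => (1 - theta σ k) * psiHat p τ σ x₀ I k + theta σ k * D.psi (iter D p τ σ x₀ I k).1
      + theta σ k / p * (D.psi (iter D p τ σ x₀ I (k + 1)).1 - D.psi (iter D p τ σ x₀ I k).1)

variable {D}

lemma iter_congr {p : ℝ} {τ σ : ℕ → ℝ} {x₀ : Vec m} {I J : ℕ → Finset (Fin d)} {k : ℕ}
    (h : ∀ j < k, I j = J j) : iter D p τ σ x₀ I k = iter D p τ σ x₀ J k := by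
  induction k with
  | zero => rfl
  | succ k ih =>
    rw [iter, iter, ih fun j hj => h j (hj.trans k.lt_succ_self), h k k.lt_succ_self]

lemma psiHat_congr {p : ℝ} {τ σ : ℕ → ℝ} {x₀ : Vec m} {I J : ℕ → Finset (Fin d)} {k : ℕ}
    (h : ∀ j < k, I j = J j) : psiHat D p τ σ x₀ I k = psiHat D p τ σ x₀ J k := by
  induction k with
  | zero => rfl
  | succ k ih =>
    have h' : ∀ j < k, I j = J j := fun j hj => h j (hj.trans k.lt_succ_self)
    rw [psiHat, psiHat, ih h', iter_congr h, iter_congr h']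

lemma iter_fst_mem_dom (hD : D.Regular) {p : ℝ} {τ σ : ℕ → ℝ} (hp : 0 < p) (hτ : ∀ k, 0 < τ k)
    {x₀ : Vec m} (hx₀ : x₀ ∈ D.dom) (I : ℕ → Finset (Fin d)) (k : ℕ) :
    (iter D p τ σ x₀ I k).1 ∈ D.dom := by
  induction k with
  | zero => exact hx₀
  | succ k ih => exact xNext_mem_dom hD hp (hτ k) (I k) ih

lemma StepRules.theta_pos {α κ p : ℝ} {τ σ : ℕ → ℝ} (hS : StepRules α κ p τ σ) (k : ℕ) :
    0 < theta σ k := div_pos (hS.σ_pos k) (hS.weight_pos k)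

lemma StepRules.theta_le {α κ p : ℝ} {τ σ : ℕ → ℝ} (hS : StepRules α κ p τ σ) (k : ℕ) :
    theta σ k ≤ p := by
  rw [theta, div_le_iff₀ (hS.weight_pos k)]
  exact hS.σ_le k

lemma StepRules.theta_succ_mul_le {α κ p : ℝ} {τ σ : ℕ → ℝ} (hS : StepRules α κ p τ σ) (k : ℕ) :
    theta σ (k + 1) * (1 - p) ≤ (1 - theta σ (k + 1)) * theta σ k := by
  have h0 := hS.weight_pos k
  have h1 := hS.weight_pos (k + 1)
  have h2 := hS.one_sub_mul_le k
  have e : (1 - theta σ (k + 1)) * theta σ k = σ k / weight σ (k + 1) := by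
    have : 1 - theta σ (k + 1) = weight σ k / weight σ (k + 1) := by
      rw [theta, eq_div_iff h1.ne', sub_mul, div_mul_cancel₀ _ h1.ne', weight]; ring
    rw [this, theta]
    field_simp
  rw [e, theta, div_mul_eq_mul_div, div_le_div_iff_of_pos_right h1]
  linarith

/-- `(w^k, psiHat k)` is a convex combination of `(x^k, Ψ(x^k))` and a point of the epigraph of `Ψ`,
with enough weight on the former for the next step to be a convex combination as well. -/
lemma exists_epigraph_combination (hD : D.Regular) {α κ p : ℝ} {τ σ : ℕ → ℝ}
    (hS : StepRules α κ p τ σ) {x₀ : Vec m} (hx₀ : x₀ ∈ D.dom) (I : ℕ → Finset (Fin d)) (k : ℕ) :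
    ∃ e ∈ {z : Vec m × ℝ | z.1 ∈ D.dom ∧ D.psi z.1 ≤ z.2}, ∃ b : ℝ, 0 ≤ b ∧ b ≤ 1 ∧
      theta σ k * (1 - p) ≤ p * (1 - theta σ k) * b ∧
      ((iter D p τ σ x₀ I k).2, psiHat D p τ σ x₀ I k)
        = (1 - b) • e + b • ((iter D p τ σ x₀ I k).1, D.psi (iter D p τ σ x₀ I k).1) := by
  have hp := hS.p_pos
  have hp1 := hS.p_lt_one
  induction k with
  | zero =>
    refine ⟨(x₀, D.psi x₀), ⟨hx₀, le_rfl⟩, 1, zero_le_one, le_rfl, ?_, ?_⟩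
    · have := hS.theta_le 0
      linarith
    · simp [iter, psiHat]
  | succ k ih =>
    obtain ⟨e, he, b, hb0, hb1, hb, heq⟩ := ih
    have hdom := iter_fst_mem_dom (σ := σ) hD hp hS.τ_pos hx₀ I k
    have hθ := hS.theta_pos k
    have hθp := hS.theta_le k
    have hsucc := hS.theta_succ_mul_le k
    set θ := theta σ k with hθdef
    set X := (iter D p τ σ x₀ I k).1 with hX
    set X' := (iter D p τ σ x₀ I (k + 1)).1 with hX'
    -- This is the coefficient left on x^k after the step. The invariant carried through the
    -- induction is precisely its nonnegativity.
    have hq : 0 ≤ (1 - θ) * b + θ - θ / p := by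
      have : (1 - θ) * b + θ - θ / p = (p * (1 - θ) * b - θ * (1 - p)) / p := by
        field_simp; ring
      rw [this]
      apply div_nonneg _ hp.le
      linarith
    have hconv := hD.convexOn_psi.convex_epigraph
    obtain ⟨e', he', hsum⟩ := hconv.exists_mem_add_smul_eq (p := (1 - θ) * (1 - b)) he
      (show (X, D.psi X) ∈ {z : Vec m × ℝ | z.1 ∈ D.dom ∧ D.psi z.1 ≤ z.2} from ⟨hdom, le_rfl⟩)
      (mul_nonneg (by linarith) (by linarith)) hq
    have hc : (1 - θ) * (1 - b) + ((1 - θ) * b + θ - θ / p) = 1 - θ / p := by ring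
    rw [hc] at hsum
    -- The fresh point x^{k+1} carries weight θ_k/p. With b = θ_k/p the next invariant is
    -- `theta_succ_mul_le`.
    refine ⟨e', he', θ / p, by positivity, by rwa [div_le_one hp], ?_, ?_⟩
    · rw [mul_div_assoc', mul_comm p, mul_assoc, mul_comm p, ← mul_assoc,
        mul_div_cancel_right₀ _ hp.ne']
      exact hsucc
    · rw [hsum]
      have hw : (iter D p τ σ x₀ I k).2 = (1 - b) • e.1 + b • X := congrArg Prod.fst heq
      have hf : psiHat D p τ σ x₀ I k = (1 - b) * e.2 + b * D.psi X := congrArg Prod.snd heq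
      refine Prod.ext ?_ ?_
      · have hP : (WithLp.toLp 2 (Pmat m p *ᵥ (X' - X).ofLp) : Vec m) = (1 / p) • (X' - X) := by
          ext c
          simp [Pmat, Matrix.mulVec_diagonal]
        have h1 : (iter D p τ σ x₀ I (k + 1)).2 = zPoint θ (iter D p τ σ x₀ I k)
            + θ • WithLp.toLp 2 (Pmat m p *ᵥ (X' - X).ofLp) := rfl
        simp only [Prod.fst_add, Prod.smul_fst]
        rw [h1, hP, zPoint, hw, ← hX]
        module
      · simp only [Prod.snd_add, Prod.smul_snd, smul_eq_mul]
        rw [psiHat, hf]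
        ring

lemma iter_snd_mem_dom_and_le (hD : D.Regular) {α κ p : ℝ} {τ σ : ℕ → ℝ}
    (hS : StepRules α κ p τ σ) {x₀ : Vec m} (hx₀ : x₀ ∈ D.dom) (I : ℕ → Finset (Fin d)) (k : ℕ) :
    (iter D p τ σ x₀ I k).2 ∈ D.dom ∧ D.psi (iter D p τ σ x₀ I k).2 ≤ psiHat D p τ σ x₀ I k := by
  obtain ⟨e, he, b, hb0, hb1, -, heq⟩ := exists_epigraph_combination hD hS hx₀ I k
  have hdom := iter_fst_mem_dom (σ := σ) hD hS.p_pos hS.τ_pos hx₀ I k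
  have := hD.convexOn_psi.convex_epigraph he
    (show ((iter D p τ σ x₀ I k).1, D.psi (iter D p τ σ x₀ I k).1) ∈
      {z : Vec m × ℝ | z.1 ∈ D.dom ∧ D.psi z.1 ≤ z.2} from ⟨hdom, le_rfl⟩)
    (by linarith : 0 ≤ 1 - b) hb0 (by ring)
  rw [← heq] at this
  exact this

end Trajectory

/-! ### The energy and its bounds. -/

section Energy

variable {d q : ℕ} {m : Fin d → ℕ} {D : Data d q m}

lemma Data.IsSaddle.psi_add_le (hD : D.Regular) {xs y : Vec m} (hs : D.IsSaddle xs y) {u : Vec m}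
    (hu : u ∈ D.dom) : D.psi xs + inner ℝ (D.opA y) (D.opA (u - xs)) + 1 / 2 * wnorm D.μ (u - xs)
      ≤ D.psi u := by
  have := hD.psi_add_wnorm_le hs.1 hu
  rwa [D.inner_transpose_mul_mulVec] at this

lemma wnorm_μ_nonneg (hD : D.Regular) (v : Vec m) : 0 ≤ wnorm D.μ v :=
  Finset.sum_nonneg fun i _ => by
    have := hD.μ_pos i
    positivity

lemma norm_sq_le_mul_wnorm (hD : D.Regular) (v : Vec m) :
    ‖v‖ ^ 2 ≤ (∑ i, (D.μ i)⁻¹) * wnorm D.μ v := by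
  rw [norm_sq_eq_sum_blk, Finset.sum_mul]
  refine Finset.sum_le_sum fun i _ => ?_
  have hμ := hD.μ_pos i
  rw [← div_eq_inv_mul, le_div_iff₀ hμ, mul_comm]
  exact Finset.single_le_sum (f := fun i => D.μ i * ‖blk i v‖ ^ 2) (fun j _ => by
    have := hD.μ_pos j
    positivity) (Finset.mem_univ i)

/-- On the feasible set A(u - xs) = 0, so the linear term of the saddle inequality vanishes and
strong convexity alone remains. -/
lemma solutions_eq_singleton (hD : D.Regular) {xs y : Vec m} (hs : D.IsSaddle xs y) :
    D.solutions = {xs} := by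
  have hxs := hD.Psi_ne_top_iff.1 hs.1.1
  have hopA : ∀ u ∈ D.feasible, D.opA (u - xs) = 0 := by
    intro u hu
    have h1 := hu xs
    rw [D.h_eq_of_normal hs.2 u] at h1
    have : ‖D.opA (u - xs)‖ ^ 2 ≤ 0 := by linarith
    exact norm_eq_zero.1 (pow_eq_zero_iff two_ne_zero |>.1 (le_antisymm this (sq_nonneg _)))
  have hle : ∀ u ∈ D.feasible, u ∈ D.dom → D.psi xs + 1 / 2 * wnorm D.μ (u - xs) ≤ D.psi u := by
    intro u hu hud
    have := hs.psi_add_le hD hud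
    rwa [hopA u hu, inner_zero_right, add_zero] at this
  have hfeas : xs ∈ D.feasible := fun u => by
    rw [D.h_eq_of_normal hs.2 u]
    have : 0 ≤ ‖D.opA (u - xs)‖ ^ 2 := sq_nonneg _
    linarith
  ext u
  rw [Set.mem_singleton_iff]
  refine ⟨fun ⟨hu, hut, hmin⟩ => ?_, fun h => ?_⟩
  · have hud := hD.Psi_ne_top_iff.1 hut
    have h1 := hle u hu hud
    have h2 := hmin xs hfeas
    rw [hD.Psi_eq_coe hud, hD.Psi_eq_coe hxs, EReal.coe_le_coe_iff] at h2
    by_contra hne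
    have := wnorm_pos hD (sub_ne_zero.2 hne)
    linarith
  · subst h
    refine ⟨hfeas, hs.1.1, fun v hv => ?_⟩
    by_cases hvd : v ∈ D.dom
    · have h1 := hle v hv hvd
      have h2 := wnorm_μ_nonneg hD (v - u)
      rw [hD.Psi_eq_coe hxs, hD.Psi_eq_coe hvd, EReal.coe_le_coe_iff]
      linarith
    · rw [not_not.1 (mt hD.Psi_ne_top_iff.1 hvd)]
      exact le_top

/-- The Lyapunov function along a trajectory, shifted to be nonnegative, plus the accumulated
decrease. -/
def energy (D : Data d q m) (p : ℝ) (τ σ : ℕ → ℝ) (x₀ xs y : Vec m) (k : ℕ)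
    (I : ℕ → Finset (Fin d)) : ℝ :=
  lyap D xs (weight σ k - σ k) (σ k * (1 / τ k + 1 / p - 1)) (iter D p τ σ x₀ I k)
      (psiHat D p τ σ x₀ I k) + 1 / 2 * ‖D.opA y‖ ^ 2
    + ∑ j ∈ Finset.range k, σ j ^ 2 * (1 / 2 * ‖D.opA ((iter D p τ σ x₀ I j).1 - xs)‖ ^ 2)

lemma dependsOnFirst_energy (p : ℝ) (τ σ : ℕ → ℝ) (x₀ xs y : Vec m) (k : ℕ) :
    DependsOnFirst k (energy D p τ σ x₀ xs y k) := by
  intro I J h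
  rw [energy, energy, iter_congr h, psiHat_congr h]
  congr 1
  refine Finset.sum_congr rfl fun j hj => ?_
  rw [iter_congr fun i hi => h i (hi.trans (Finset.mem_range.1 hj))]

/-- The hypotheses of the convergence analysis. -/
structure Assumptions (D : Data d q m) (Q : Finset (Fin d) → ℝ) (α κ p : ℝ) (τ σ : ℕ → ℝ)
    (x₀ xs y : Vec m) : Prop where
  regular : D.Regular
  rules : StepRules α κ p τ σ
  law : IsUniformLaw Q p
  quad : ∀ v : Vec m, ∑ I, Q I * ((1 / p) ^ 2 * ‖D.opA (mask I v)‖ ^ 2) ≤ α⁻¹ * (p * wnorm D.μ v)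
  kappa_le : ∀ i, 0 < m i → D.L i + D.μ i ≤ κ * (p * D.μ i)
  saddle : D.IsSaddle xs y
  mem_dom : x₀ ∈ D.dom

namespace Assumptions

variable {Q : Finset (Fin d) → ℝ} {α κ p : ℝ} {τ σ : ℕ → ℝ} {x₀ xs y : Vec m}
  (hyp : Assumptions D Q α κ p τ σ x₀ xs y)
include hyp

lemma weight_sub_nonneg (k : ℕ) : 0 ≤ weight σ k - σ k := by
  have h1 := hyp.rules.σ_le k
  have h2 := hyp.rules.weight_pos k
  have h3 := hyp.rules.p_lt_one
  nlinarith

lemma sum_energy_le (k : ℕ) (I : ℕ → Finset (Fin d)) :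
    ∑ F, Q F * energy D p τ σ x₀ xs y (k + 1) (Function.update I k F)
      ≤ energy D p τ σ x₀ xs y k I := by
  have hS := hyp.rules
  have hxs := hyp.regular.Psi_ne_top_iff.1 hyp.saddle.1.1
  have hone := sum_lyap_le hyp.regular hS.p_pos (hS.τ_pos k) (hS.weight_pos k) (hS.σ_pos k)
    hS.α_pos (hS.σ_eq k) hyp.law hyp.quad hyp.kappa_le hxs hyp.saddle.2
    (iter D p τ σ x₀ I k) (psiHat D p τ σ x₀ I k)
  have hupd : ∀ F, ∀ j < k, Function.update I k F j = I j := fun F j hj =>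
    Function.update_of_ne hj.ne _ _
  have e : ∀ F, energy D p τ σ x₀ xs y (k + 1) (Function.update I k F)
      = lyap D xs (weight σ k) (σ k * (1 / τ k + 1 / p))
        (xNext D p (τ k) (weight σ k) (σ k / weight σ k) F (iter D p τ σ x₀ I k),
          zPoint (σ k / weight σ k) (iter D p τ σ x₀ I k) + (σ k / weight σ k) •
          WithLp.toLp 2 (Pmat m p *ᵥ (xNext D p (τ k) (weight σ k) (σ k / weight σ k) F
            (iter D p τ σ x₀ I k) - (iter D p τ σ x₀ I k).1).ofLp))
        ((1 - σ k / weight σ k) * psiHat D p τ σ x₀ I k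
          + σ k / weight σ k * D.psi (iter D p τ σ x₀ I k).1
          + σ k / weight σ k / p * (D.psi (xNext D p (τ k) (weight σ k) (σ k / weight σ k) F
            (iter D p τ σ x₀ I k)) - D.psi (iter D p τ σ x₀ I k).1))
        + (1 / 2 * ‖D.opA y‖ ^ 2 + ∑ j ∈ Finset.range (k + 1),
          σ j ^ 2 * (1 / 2 * ‖D.opA ((iter D p τ σ x₀ I j).1 - xs)‖ ^ 2)) := by
    intro F
    have h1 : iter D p τ σ x₀ (Function.update I k F) (k + 1)
        = (xNext D p (τ k) (weight σ k) (σ k / weight σ k) F (iter D p τ σ x₀ I k),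
          zPoint (σ k / weight σ k) (iter D p τ σ x₀ I k) + (σ k / weight σ k) •
          WithLp.toLp 2 (Pmat m p *ᵥ (xNext D p (τ k) (weight σ k) (σ k / weight σ k) F
            (iter D p τ σ x₀ I k) - (iter D p τ σ x₀ I k).1).ofLp)) := by
      rw [iter, iter_congr (hupd F), Function.update_self]
      rfl
    -- Here the chaining happens: `σ_succ` converts the coefficient of the distance at index k+1,
    -- and S_{k+1} - σ_{k+1} is S_k.
    rw [energy, psiHat, h1, hS.σ_succ, psiHat_congr (hupd F), iter_congr (hupd F), weight,
      add_sub_cancel_right, add_assoc]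
    congr 2
    refine Finset.sum_congr rfl fun j hj => ?_
    rw [iter_congr fun i hi =>
      hupd F i (hi.trans_le (Nat.lt_succ_iff.1 (Finset.mem_range.1 hj)))]
  have hadd : ∀ (g : Finset (Fin d) → ℝ) (c : ℝ),
      ∑ F, Q F * (g F + c) = ∑ F, Q F * g F + c := by
    intro g c
    simp_rw [mul_add]
    rw [Finset.sum_add_distrib, ← Finset.sum_mul, hyp.law.sum_eq_one, one_mul]
  simp_rw [e]
  rw [hadd, Finset.sum_range_succ, energy]
  linarith

/-- The energy dominates every quantity of interest. -/
lemma energy_bounds (k : ℕ) (I : ℕ → Finset (Fin d)) :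
    let T := weight σ k - σ k
    let x := (iter D p τ σ x₀ I k).1
    let w := (iter D p τ σ x₀ I k).2
    let B := energy D p τ σ x₀ xs y k I
    0 ≤ B ∧ T * wnorm D.μ (w - xs) ≤ 2 * B ∧
      T * ‖D.opA (w - xs)‖ ≤ B + 1 / 2 + ‖D.opA y‖ ∧
      σ k * (1 / τ k + 1 / p - 1) * wnorm D.μ (x - xs) ≤ 2 * B ∧
      ∑ j ∈ Finset.range k, σ j ^ 2 * (1 / 2 * ‖D.opA ((iter D p τ σ x₀ I j).1 - xs)‖ ^ 2) ≤ B ∧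
      T * |D.psi w - D.psi xs| ≤ B + ‖D.opA y‖ * (B + 1 / 2 + ‖D.opA y‖) := by
  intro T x w B
  have hS := hyp.rules
  have hT : 0 ≤ T := hyp.weight_sub_nonneg k
  obtain ⟨hwd, hwf⟩ := iter_snd_mem_dom_and_le hyp.regular hS hyp.mem_dom I k
  have hsad := hyp.saddle.psi_add_le hyp.regular hwd
  change w ∈ D.dom at hwd
  change D.psi w ≤ psiHat D p τ σ x₀ I k at hwf
  change D.psi xs + inner ℝ (D.opA y) (D.opA (w - xs)) + 1 / 2 * wnorm D.μ (w - xs) ≤ D.psi w at hsad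
  set f := psiHat D p τ σ x₀ I k
  set u := D.opA (w - xs)
  set y' := D.opA y
  set ρ := σ k * (1 / τ k + 1 / p - 1)
  set acc := ∑ j ∈ Finset.range k, σ j ^ 2 * (1 / 2 * ‖D.opA ((iter D p τ σ x₀ I j).1 - xs)‖ ^ 2)
  have hacc : 0 ≤ acc := Finset.sum_nonneg fun j _ => by positivity
  have hρ : 0 ≤ ρ := by
    have h1 := hS.σ_pos k
    have h2 : 0 < 1 / τ k := one_div_pos.2 (hS.τ_pos k)
    have h3 := hS.one_lt_inv
    exact mul_nonneg h1.le (by linarith)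
  have hWx : 0 ≤ wnorm D.μ (x - xs) := wnorm_μ_nonneg hyp.regular _
  have hWw : 0 ≤ wnorm D.μ (w - xs) := wnorm_μ_nonneg hyp.regular _
  -- Completing the square with the multiplier term makes every summand nonnegative, the first by
  -- the saddle inequality and f ≥ Ψ(w).
  have hB : B = T * (f - D.psi xs - inner ℝ y' u) + 1 / 2 * ‖T • u + y'‖ ^ 2
      + ρ / 2 * wnorm D.μ (x - xs) + acc := by
    have e : B = T * (f - D.psi xs) + T ^ 2 * (1 / 2 * ‖u‖ ^ 2) + ρ / 2 * wnorm D.μ (x - xs)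
      + 1 / 2 * ‖y'‖ ^ 2 + acc := rfl
    rw [e, norm_add_sq_real, norm_smul, mul_pow, Real.norm_eq_abs, sq_abs, real_inner_smul_left,
      real_inner_comm]
    ring
  have h1 : T * (1 / 2 * wnorm D.μ (w - xs)) ≤ T * (f - D.psi xs - inner ℝ y' u) := by
    gcongr; linarith
  have h2 : 0 ≤ T * (1 / 2 * wnorm D.μ (w - xs)) := by positivity
  have h3 : 0 ≤ ‖T • u + y'‖ ^ 2 := sq_nonneg _
  have h4 : 0 ≤ ρ / 2 * wnorm D.μ (x - xs) := by positivity
  -- The bound a ≤ (a² + 1)/2 replaces a square root of B by B + 1/2, keeping the estimate affine in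
  -- B so that it can be integrated.
  have h5 : T * ‖u‖ ≤ B + 1 / 2 + ‖y'‖ := by
    have e1 : T * ‖u‖ = ‖T • u‖ := by rw [norm_smul, Real.norm_eq_abs, abs_of_nonneg hT]
    have e2 : ‖T • u‖ ≤ ‖T • u + y'‖ + ‖y'‖ := by
      have := norm_sub_le (T • u + y') y'
      rwa [add_sub_cancel_right] at this
    nlinarith [sq_nonneg (‖T • u + y'‖ - 1)]
  have h6 : |inner ℝ y' u| ≤ ‖y'‖ * ‖u‖ := abs_real_inner_le_norm _ _
  have h7 : T * |inner ℝ y' u| ≤ ‖y'‖ * (B + 1 / 2 + ‖y'‖) := by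
    calc _ ≤ T * (‖y'‖ * ‖u‖) := by gcongr
      _ = ‖y'‖ * (T * ‖u‖) := by ring
      _ ≤ _ := by gcongr
  refine ⟨by linarith, by linarith, h5, by linarith, by linarith, ?_⟩
  have h8 : |D.psi w - D.psi xs| ≤ (f - D.psi xs - inner ℝ y' u) + |inner ℝ y' u| := by
    rw [abs_le]
    have h9 := neg_abs_le (inner ℝ y' u)
    have h10 := le_abs_self (inner ℝ y' u)
    constructor <;> linarith
  calc _ ≤ T * ((f - D.psi xs - inner ℝ y' u) + |inner ℝ y' u|) := by gcongr
    _ ≤ _ := by rw [mul_add]; linarith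

end Assumptions

end Energy

/-! ### Convergence rates. -/

lemma isBigO_one_div_pow {a : ℕ → ℝ} {n : ℕ} {c C : ℝ} (hc : 0 < c)
    (h : ∀ k : ℕ, c * (k : ℝ) ^ n * |a k| ≤ C) : a =O[atTop] fun k : ℕ => 1 / (k : ℝ) ^ n := by
  refine IsBigO.of_bound (C / c) ?_
  filter_upwards [eventually_ge_atTop 1] with k hk
  have hk' : 0 < (k : ℝ) ^ n := by
    have : 0 < (k : ℝ) := by exact_mod_cast hk
    positivity
  rw [Real.norm_eq_abs, Real.norm_of_nonneg (by positivity), mul_one_div, le_div_iff₀ hk',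
    le_div_iff₀ hc]
  linarith [h k]

lemma isLittleO_one_div_pow {a b : ℕ → ℝ} {n : ℕ} {c : ℝ} (hc : 0 < c)
    (hb : Tendsto b atTop (𝓝 0)) (h : ∀ k : ℕ, c * (k : ℝ) ^ n * |a k| ≤ b k) :
    a =o[atTop] fun k : ℕ => 1 / (k : ℝ) ^ n := by
  rw [isLittleO_iff]
  intro ε hε
  filter_upwards [eventually_ge_atTop 1, hb.eventually_lt_const (mul_pos hε hc)] with k hk hbk
  have hk' : 0 < (k : ℝ) ^ n := by
    have : 0 < (k : ℝ) := by exact_mod_cast hk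
    positivity
  rw [Real.norm_eq_abs, Real.norm_of_nonneg (by positivity), mul_one_div, le_div_iff₀ hk']
  refine le_of_mul_le_mul_left ?_ hc
  linarith [h k]

lemma tendsto_of_sq_mul_norm_sq_le {E : Type*} [NormedAddCommGroup E] {x : ℕ → E} {a : E} {C : ℝ}
    (h : ∀ k : ℕ, (k : ℝ) ^ 2 * ‖x k - a‖ ^ 2 ≤ C) : Tendsto x atTop (𝓝 a) := by
  rw [tendsto_iff_norm_sub_tendsto_zero]
  have hC : 0 ≤ C := by have := h 0; simpa using this
  refine squeeze_zero' (Eventually.of_forall fun k => norm_nonneg _) ?_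
    (tendsto_const_div_atTop_nhds_zero_nat (√C))
  filter_upwards [eventually_ge_atTop 1] with k hk
  have hk' : 0 < (k : ℝ) := by exact_mod_cast hk
  rw [le_div_iff₀ hk']
  apply Real.le_sqrt_of_sq_le
  linarith [h k]

namespace Assumptions

variable {d q : ℕ} {m : Fin d → ℕ} {D : Data d q m} {Q : Finset (Fin d) → ℝ} {α κ p : ℝ}
  {τ σ : ℕ → ℝ} {x₀ xs y : Vec m} (hyp : Assumptions D Q α κ p τ σ x₀ xs y)
include hyp

/-- The rates along a trajectory of bounded energy. -/
lemma rates_of_energy_le {I : ℕ → Finset (Fin d)} {C : ℝ}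
    (hC : ∀ k, energy D p τ σ x₀ xs y k I ≤ C) :
    ((fun k => D.h (iter D p τ σ x₀ I k).1 - D.h xs) =o[atTop] fun k : ℕ => 1 / (k : ℝ) ^ 2) ∧
    ((fun k => D.h (iter D p τ σ x₀ I k).2 - D.h xs) =O[atTop] fun k : ℕ => 1 / (k : ℝ) ^ 4) ∧
    Tendsto (fun k => (iter D p τ σ x₀ I k).1) atTop (𝓝 xs) ∧
    Tendsto (fun k => (iter D p τ σ x₀ I k).2) atTop (𝓝 xs) ∧
    (fun k => |D.psi (iter D p τ σ x₀ I k).2 - D.psi xs|) =O[atTop]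
      fun k : ℕ => 1 / (k : ℝ) ^ 2 := by
  obtain ⟨c, hc, hlow⟩ := hyp.rules.exists_sq_le
  have hb := fun k => hyp.energy_bounds k I
  have hh : ∀ u, D.h u - D.h xs = 1 / 2 * ‖D.opA (u - xs)‖ ^ 2 := fun u => by
    rw [D.h_eq_of_normal hyp.saddle.2 u]; ring
  have hK : 0 ≤ ∑ i, (D.μ i)⁻¹ := Finset.sum_nonneg fun i _ => (inv_pos.2 (hyp.regular.μ_pos i)).le
  set K := ∑ i, (D.μ i)⁻¹
  have htends : ∀ (z : ℕ → Vec m) (r : ℕ → ℝ), (∀ k : ℕ, c * (k : ℝ) ^ 2 ≤ r k) →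
      (∀ k, r k * wnorm D.μ (z k - xs) ≤ 2 * C) → Tendsto z atTop (𝓝 xs) := by
    intro z r hr hz
    refine tendsto_of_sq_mul_norm_sq_le (C := K * (2 * C) / c) fun k => ?_
    have h1 := norm_sq_le_mul_wnorm hyp.regular (z k - xs)
    have h2 := wnorm_μ_nonneg hyp.regular (z k - xs)
    rw [le_div_iff₀ hc]
    calc (k : ℝ) ^ 2 * ‖z k - xs‖ ^ 2 * c = c * (k : ℝ) ^ 2 * ‖z k - xs‖ ^ 2 := by ring
      _ ≤ c * (k : ℝ) ^ 2 * (K * wnorm D.μ (z k - xs)) := by gcongr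
      _ = K * (c * (k : ℝ) ^ 2 * wnorm D.μ (z k - xs)) := by ring
      _ ≤ K * (r k * wnorm D.μ (z k - xs)) := by gcongr; exact hr k
      _ ≤ _ := mul_le_mul_of_nonneg_left (hz k) hK
  refine ⟨?_, ?_, ?_, ?_, ?_⟩
  · have hsum : Summable fun j =>
        σ j ^ 2 * (1 / 2 * ‖D.opA ((iter D p τ σ x₀ I j).1 - xs)‖ ^ 2) :=
      summable_of_sum_range_le (fun j => by positivity) fun k => (hb k).2.2.2.2.1.trans (hC k)
    refine isLittleO_one_div_pow hc hsum.tendsto_atTop_zero fun k => ?_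
    rw [hh, abs_of_nonneg (by positivity)]
    gcongr
    exact (hlow k).2.1
  · refine isBigO_one_div_pow (c := c ^ 2)
      (C := 1 / 2 * (C + 1 / 2 + ‖D.opA y‖) ^ 2) (by positivity) fun k => ?_
    rw [hh, abs_of_nonneg (by positivity)]
    have h1 : c * (k : ℝ) ^ 2 * ‖D.opA ((iter D p τ σ x₀ I k).2 - xs)‖
        ≤ C + 1 / 2 + ‖D.opA y‖ := by
      have h2 := (hb k).2.2.1
      have h3 := hC k
      have h4 : c * (k : ℝ) ^ 2 * ‖D.opA ((iter D p τ σ x₀ I k).2 - xs)‖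
          ≤ (weight σ k - σ k) * ‖D.opA ((iter D p τ σ x₀ I k).2 - xs)‖ := by
        gcongr; exact (hlow k).1
      linarith
    calc _ = 1 / 2 * (c * (k : ℝ) ^ 2 * ‖D.opA ((iter D p τ σ x₀ I k).2 - xs)‖) ^ 2 := by ring
      _ ≤ _ := by gcongr
  · exact htends _ _ (fun k => (hlow k).2.2) fun k => by
      have h1 := (hb k).2.2.2.1
      have h2 := hC k
      linarith
  · exact htends _ _ (fun k => (hlow k).1) fun k => by
      have h1 := (hb k).2.1
      have h2 := hC k
      linarith
  · refine isBigO_one_div_pow (C := C + ‖D.opA y‖ * (C + 1 / 2 + ‖D.opA y‖)) hc fun k => ?_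
    rw [abs_abs]
    calc _ ≤ (weight σ k - σ k) * |D.psi (iter D p τ σ x₀ I k).2 - D.psi xs| := by
          gcongr; exact (hlow k).1
      _ ≤ _ := (hb k).2.2.2.2.2
      _ ≤ _ := by gcongr <;> exact hC k

lemma isBigO_integral_psi {Ω : Type*} [MeasurableSpace Ω] {Pr : Measure Ω} [IsProbabilityMeasure Pr]
    {ι : ℕ → Ω → Finset (Fin d)} (hι : ∀ k, Measurable (ι k)) (hind : iIndepFun ι Pr)
    (hQ : ∀ k F, (Pr.map (ι k)).real {F} = Q F) :
    (∀ k, Integrable (fun ω => D.psi (iter D p τ σ x₀ (fun j => ι j ω) k).2 - D.psi xs) Pr) ∧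
    (fun k => ∫ ω, |D.psi (iter D p τ σ x₀ (fun j => ι j ω) k).2 - D.psi xs| ∂Pr) =O[atTop]
      fun k : ℕ => 1 / (k : ℝ) ^ 2 := by
  obtain ⟨c, hc, hlow⟩ := hyp.rules.exists_sq_le
  have hint : ∀ k, Integrable (fun ω =>
      D.psi (iter D p τ σ x₀ (fun j => ι j ω) k).2 - D.psi xs) Pr := by
    intro k
    have hdep : DependsOnFirst k
        (fun I : ℕ → Finset (Fin d) => D.psi (iter D p τ σ x₀ I k).2 - D.psi xs) := by
      intro I J h
      simp only [iter_congr h]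
    exact hdep.integrable hι
  refine ⟨hint, ?_⟩
  set C := ∫ ω, energy D p τ σ x₀ xs y 0 (fun j => ι j ω) ∂Pr with hCdef
  refine isBigO_one_div_pow (C := C + ‖D.opA y‖ * (C + 1 / 2 + ‖D.opA y‖)) hc fun k => ?_
  have henergy := (dependsOnFirst_energy (D := D) p τ σ x₀ xs y k).integrable (Pr := Pr) hι
  have hCk : ∫ ω, energy D p τ σ x₀ xs y k (fun j => ι j ω) ∂Pr ≤ C :=
    integral_le_integral_zero hι hind hQ (dependsOnFirst_energy p τ σ x₀ xs y)
      hyp.sum_energy_le k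
  rw [abs_of_nonneg (integral_nonneg fun ω => abs_nonneg _), ← integral_const_mul]
  -- The bound is affine in the energy, so its mean is controlled by the initial energy without
  -- higher moments.
  calc _ ≤ ∫ ω, ((1 + ‖D.opA y‖) * energy D p τ σ x₀ xs y k (fun j => ι j ω)
            + ‖D.opA y‖ * (1 / 2 + ‖D.opA y‖)) ∂Pr := by
        refine integral_mono ((hint k).abs.const_mul _)
          ((henergy.const_mul _).add (integrable_const _)) fun ω => ?_
        have h1 := (hyp.energy_bounds k fun j => ι j ω).2.2.2.2.2
        have h2 : c * (k : ℝ) ^ 2 * |D.psi (iter D p τ σ x₀ (fun j => ι j ω) k).2 - D.psi xs|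
            ≤ (weight σ k - σ k)
              * |D.psi (iter D p τ σ x₀ (fun j => ι j ω) k).2 - D.psi xs| := by
          gcongr; exact (hlow k).1
        simp only
        linarith
    _ = (1 + ‖D.opA y‖) * ∫ ω, energy D p τ σ x₀ xs y k (fun j => ι j ω) ∂Pr
          + ‖D.opA y‖ * (1 / 2 + ‖D.opA y‖) := by
        rw [integral_add (henergy.const_mul _) (integrable_const _), integral_const_mul]
        simp
    _ ≤ (1 + ‖D.opA y‖) * C + ‖D.opA y‖ * (1 / 2 + ‖D.opA y‖) := by gcongr
    _ = _ := by ring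

end Assumptions

end RBCD

end

/-! ### Assembly of the conclusions. -/

theorem theorem2 {d q : ℕ} {m : Fin d → ℕ} (D : RBCD.Data d q m)
    (hD : D.Regular) (hA : D.A ≠ 0) (hsaddle : ∃ x y : RBCD.Vec m, D.IsSaddle x y)
    {Ω : Type*} [MeasurableSpace Ω] (Pr : Measure Ω) [IsProbabilityMeasure Pr]
    (ι : ℕ → Ω → Finset (Fin d)) (p : ℝ) (hι : RBCD.IsUniformSampling Pr ι p)
    (α β κ : ℝ) (hα : α = RBCD.alpha D Pr (ι 0) p) (hβ : β = RBCD.beta D Pr (ι 0) p)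
    (hκ : κ = β / α)
    (τ₀ : ℝ) (hτ₀ : 0 < τ₀) (hτ₀κ : τ₀ < 1 / κ)
    (τ σ : ℕ → ℝ) (hτ : τ = RBCD.tau κ p τ₀) (hσ : σ = RBCD.sigma α β τ) (hσ₀ : σ 0 ≤ p)
    (x₀ : RBCD.Vec m) (hx₀ : D.R x₀ ≠ ⊤)
    (x w : ℕ → Ω → RBCD.Vec m)
    (hx : ∀ k ω, x k ω = (RBCD.iter D p τ σ x₀ (fun j => ι j ω) k).1)
    (hw : ∀ k ω, w k ω = (RBCD.iter D p τ σ x₀ (fun j => ι j ω) k).2) :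
    ∃ xs : RBCD.Vec m, D.solutions = {xs} ∧
      (∀ᵐ ω ∂Pr,
        ((fun k => D.h (x k ω) - D.h xs) =o[atTop] fun k : ℕ => 1 / (k : ℝ) ^ 2) ∧
        ((fun k => D.h (w k ω) - D.h xs) =O[atTop] fun k : ℕ => 1 / (k : ℝ) ^ 4)) ∧
      (∀ᵐ ω ∂Pr, Tendsto (fun k => x k ω) atTop (𝓝 xs) ∧ Tendsto (fun k => w k ω) atTop (𝓝 xs)) ∧
      (∀ᵐ ω ∂Pr, (∀ k, D.Psi (w k ω) ≠ ⊤) ∧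
        (fun k => |(D.Psi (w k ω)).toReal - (D.Psi xs).toReal|) =O[atTop]
          fun k : ℕ => 1 / (k : ℝ) ^ 2) ∧
      (∀ k, Integrable (fun ω => (D.Psi (w k ω)).toReal - (D.Psi xs).toReal) Pr) ∧
      ((fun k => ∫ ω, |(D.Psi (w k ω)).toReal - (D.Psi xs).toReal| ∂Pr) =O[atTop]
        fun k : ℕ => 1 / (k : ℝ) ^ 2) := by
  obtain ⟨xs, y, hs⟩ := hsaddle
  have hlam := RBCD.lamMax_Xi_pos hD hA (hι.measurable 0) hι.p_pos hι.uniform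
  have hαpos : 0 < α := by rw [hα]; exact inv_pos.2 hlam
  have hκ' : κ = RBCD.kappa D p := by
    rw [hκ, hβ, RBCD.beta, ← hα, mul_div_cancel_left₀ _ hαpos.ne']
  have hκle : ∀ i, 0 < m i → D.L i + D.μ i ≤ κ * (p * D.μ i) := fun i hi => by
    rw [hκ']; exact RBCD.le_kappa_mul hD hι.p_pos hi
  -- Positivity of κ follows from 0 < τ₀ < 1/κ, which also excludes κ = 0 because 1/0 = 0.
  have hκpos : 0 < κ := by
    by_contra! h
    have := div_nonpos_of_nonneg_of_nonpos zero_le_one h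
    linarith
  have hyp : RBCD.Assumptions D (fun F => (Pr.map (ι 0)).real {F}) α κ p τ σ x₀ xs y :=
    { regular := hD
      rules := RBCD.stepRules hαpos hι.p_pos hι.p_lt_one hκpos
        (by rw [hβ, RBCD.beta, ← hα, hκ']) hτ₀ hτ₀κ hτ hσ hσ₀
      law := RBCD.isUniformLaw (hι.measurable 0) hι.uniform
      quad := fun v => by
        have := RBCD.sum_norm_opA_mask_le (Pr := Pr) hD (hι.measurable 0) hι.p_pos v
        rwa [hα, RBCD.alpha, inv_inv]
      kappa_le := hκle
      saddle := hs
      mem_dom := hD.R_ne_top_iff.1 hx₀ }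
  have hQ : ∀ k F, (Pr.map (ι k)).real {F} = (Pr.map (ι 0)).real {F} := fun k F => by
    rw [(hι.identDistrib k).map_eq]
  have hxs := hD.Psi_ne_top_iff.1 hs.1.1
  have hw_dom : ∀ k ω, w k ω ∈ D.dom := fun k ω => by
    rw [hw]
    exact (RBCD.iter_snd_mem_dom_and_le hD hyp.rules hyp.mem_dom _ k).1
  have hae := RBCD.ae_exists_forall_le hι.measurable hι.indep hQ
    (RBCD.dependsOnFirst_energy (D := D) p τ σ x₀ xs y)
    (fun k I => (hyp.energy_bounds k I).1) hyp.sum_energy_le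
  have hψ : ∀ k ω, (D.Psi (w k ω)).toReal - (D.Psi xs).toReal
      = D.psi (RBCD.iter D p τ σ x₀ (fun j => ι j ω) k).2 - D.psi xs := fun k ω => by
    rw [hD.toReal_Psi (hw_dom k ω), hD.toReal_Psi hxs, hw]
  have hexp := hyp.isBigO_integral_psi hι.measurable hι.indep hQ
  refine ⟨xs, RBCD.solutions_eq_singleton hD hs, ?_⟩
  simp only [hψ]
  refine ⟨?_, ?_, ?_, hexp.1, hexp.2⟩
  all_goals
    filter_upwards [hae] with ω ⟨C, hC⟩
    obtain ⟨h1, h2, h3, h4, h5⟩ := hyp.rates_of_energy_le hC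
  · simp only [hx, hw]
    exact ⟨h1, h2⟩
  · simp only [hx, hw]
    exact ⟨h3, h4⟩
  · exact ⟨fun k => hD.Psi_ne_top_iff.2 (hw_dom k ω), h5⟩
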